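/- Let $H$ be a finite-dimensional complex Hilbert space with $\dim H\ge 2$, and let $L(H)$ be the space of linear operators on $H$. A quantum operation from the system $H$ to itself is a completely positive linear map $\mathcal Q:L(H)\to L(H)$ with $\operatorname{Tr}[\mathcal Q(\rho)]\le \operatorname{Tr}[\rho]$ for every positive semidefinite $\rho\in L(H)$; let $\mathsf{Op}(H,H)$ be the set of all of them. A symmetry of the set of quantum operations is a bijection $\mathcal S:\mathsf{Op}(H,H)\to\mathsf{Op}(H,H)$ such that $\mathcal S(p\,\mathcal Q+(1-p)\,\mathcal R)=p\,\mathcal S(\mathcal Q)+(1-p)\,\mathcal S(\mathcal R)$ for all $\mathcal Q,\mathcal R\in\mathsf{Op}(H,H)$ and all $p\in[0,1]$, and $\mathcal S(0)=0$. For a unitary operator $U$ on $H$, let $\mathcal U:\rho\mapsto U\rho U^\dagger$ be the corresponding unitary channel, let $\mathcal U^\dagger:\rho\mapsto U^\dagger\rho U$, and let $\mathcal U^T:\rho\mapsto U^T\rho\,U^*$, where $U^T$ and $U^*$ are the transpose and the complex conjugate of $U$ with respect to a fixed but arbitrary orthonormal basis of $H$. **Theorem (No time reversal of arbitrary quantum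 operations).** No symmetry $\mathcal S$ of the set of quantum operations satisfies $\mathcal S(\mathcal U)=\mathcal U^\dagger$ for every unitary channel $\mathcal U$. Likewise, for every choice of the orthonormal basis, no symmetry $\mathcal S$ of the set of quantum operations satisfies $\mathcal S(\mathcal U)=\mathcal U^T$ for every unitary channel $\mathcal U$. -/

import Mathlib

open scoped ComplexOrder InnerProductSpace

noncomputable section

namespace QuantumEvolution

variable {Hin : Type*} [NormedAddCommGroup Hin] [InnerProductSpace ℂ Hin] [FiniteDimensional ℂ Hin]
variable {Hout : Type*} [NormedAddCommGroup Hout] [InnerProductSpace ℂ Hout]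
  [FiniteDimensional ℂ Hout]
variable {H : Type*} [NormedAddCommGroup H] [InnerProductSpace ℂ H] [FiniteDimensional ℂ H]

/-- A `k × k` block operator `A = (A i j)` with blocks in `L(H)`, seen as an operator on
`ℂᵏ ⊗ H = H ⊕ ⋯ ⊕ H`, is positive semidefinite: `⟪x, A x⟫ = ∑ i, ∑ j, ⟪x i, A i j (x j)⟫` is a
nonnegative real number for every vector `x = (x i)`. -/
def BlockPositive {k : ℕ} (A : Fin k → Fin k → (H →ₗ[ℂ] H)) : Prop :=
  ∀ x : Fin k → H, (0 : ℂ) ≤ ∑ i, ∑ j, ⟪x i, A i j (x j)⟫_ℂ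

/-- A linear map `Q : L(Hin) → L(Hout)` is completely positive: for every `k`, the map `id_k ⊗ Q`
(which applies `Q` to every block) sends positive operators on `ℂᵏ ⊗ Hin` to positive operators on
`ℂᵏ ⊗ Hout`. -/
def IsCompletelyPositive (Q : (Hin →ₗ[ℂ] Hin) →ₗ[ℂ] (Hout →ₗ[ℂ] Hout)) : Prop :=
  ∀ (k : ℕ) (A : Fin k → Fin k → (Hin →ₗ[ℂ] Hin)),
    BlockPositive A → BlockPositive (fun i j => Q (A i j))

/-- A linear map `Q : L(Hin) → L(Hout)` is trace non-increasing (on positive operators; the traces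
involved are real when `Q` is completely positive). -/
def IsTraceNonincreasing (Q : (Hin →ₗ[ℂ] Hin) →ₗ[ℂ] (Hout →ₗ[ℂ] Hout)) : Prop :=
  ∀ ρ : Hin →ₗ[ℂ] Hin, ρ.IsPositive →
    (LinearMap.trace ℂ Hout (Q ρ)).re ≤ (LinearMap.trace ℂ Hin ρ).re

variable (Hin Hout) in
/-- The set `Op(Hin, Hout)` of quantum operations: completely positive, trace non-increasing linear
maps from `L(Hin)` to `L(Hout)`. -/
def Op : Set ((Hin →ₗ[ℂ] Hin) →ₗ[ℂ] (Hout →ₗ[ℂ] Hout)) :=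
  {Q | IsCompletelyPositive Q ∧ IsTraceNonincreasing Q}

theorem zero_mem_Op : (0 : (Hin →ₗ[ℂ] Hin) →ₗ[ℂ] (Hout →ₗ[ℂ] Hout)) ∈ Op Hin Hout := by
  refine ⟨fun k A _ x => by simp, fun ρ hρ => ?_⟩
  have h := hρ.trace_nonneg
  simpa using (Complex.le_def.mp h).1

theorem mix_mem_Op {Q R : (Hin →ₗ[ℂ] Hin) →ₗ[ℂ] (Hout →ₗ[ℂ] Hout)} (hQ : Q ∈ Op Hin Hout)
    (hR : R ∈ Op Hin Hout) {p : ℝ} (hp : p ∈ Set.Icc (0 : ℝ) 1) :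
    (p : ℂ) • Q + ((1 - p : ℝ) : ℂ) • R ∈ Op Hin Hout := by
  have h0 : (0 : ℂ) ≤ (p : ℂ) := by exact_mod_cast hp.1
  have h1 : (0 : ℂ) ≤ ((1 - p : ℝ) : ℂ) := by
    have := sub_nonneg.mpr hp.2
    exact_mod_cast this
  refine ⟨fun k A hA x => ?_, fun ρ hρ => ?_⟩
  · have e := add_nonneg (mul_nonneg h0 (hQ.1 k A hA x)) (mul_nonneg h1 (hR.1 k A hA x))
    simpa only [LinearMap.add_apply, LinearMap.smul_apply, inner_add_right, inner_smul_right,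
      Finset.sum_add_distrib, Finset.mul_sum] using e
  · have e1 := mul_le_mul_of_nonneg_left (hQ.2 ρ hρ) hp.1
    have e2 := mul_le_mul_of_nonneg_left (hR.2 ρ hρ) (sub_nonneg.mpr hp.2)
    simp only [LinearMap.add_apply, LinearMap.smul_apply, map_add, map_smul, Complex.add_re,
      smul_eq_mul, Complex.re_ofReal_mul]
    linarith

/-- The null quantum operation. -/
def Op.null : Op Hin Hout := ⟨0, zero_mem_Op⟩

/-- The random mixture `p Q + (1 - p) R` of two quantum operations. -/
def Op.mix (p : ℝ) (hp : p ∈ Set.Icc (0 : ℝ) 1) (Q R : Op Hin Hout) : Op Hin Hout :=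
  ⟨(p : ℂ) • Q.1 + ((1 - p : ℝ) : ℂ) • R.1, mix_mem_Op Q.2 R.2 hp⟩

/-- An operation space symmetry from `Op(Hin, Hout)` to `Op(Kin, Kout)`: a bijection that is
consistent with randomisations and maps the null operation to the null operation. -/
structure OpSymmetry (Hin Hout Kin Kout : Type*)
    [NormedAddCommGroup Hin] [InnerProductSpace ℂ Hin] [FiniteDimensional ℂ Hin]
    [NormedAddCommGroup Hout] [InnerProductSpace ℂ Hout] [FiniteDimensional ℂ Hout]
    [NormedAddCommGroup Kin] [InnerProductSpace ℂ Kin] [FiniteDimensional ℂ Kin]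
    [NormedAddCommGroup Kout] [InnerProductSpace ℂ Kout] [FiniteDimensional ℂ Kout] where
  /-- the underlying transformation of quantum operations -/
  toFun : Op Hin Hout → Op Kin Kout
  bijective : Function.Bijective toFun
  map_mix : ∀ (p : ℝ) (hp : p ∈ Set.Icc (0 : ℝ) 1) (Q R : Op Hin Hout),
    toFun (Op.mix p hp Q R) = Op.mix p hp (toFun Q) (toFun R)
  map_null : toFun Op.null = Op.null

/-- The linear map `ρ ↦ K ρ K†` on `L(H)`. -/
def conjMap (K : H →ₗ[ℂ] H) : (H →ₗ[ℂ] H) →ₗ[ℂ] (H →ₗ[ℂ] H) where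
  toFun ρ := K * ρ * star K
  map_add' ρ σ := by rw [mul_add, add_mul]
  map_smul' c ρ := by simp

theorem conjMap_mem_Op (U : unitary (H →ₗ[ℂ] H)) : conjMap (U : H →ₗ[ℂ] H) ∈ Op H H := by
  refine ⟨fun k A hA x => ?_, fun ρ _ => ?_⟩
  · have e := hA (fun i => (star (U : H →ₗ[ℂ] H)) (x i))
    simpa [conjMap, LinearMap.star_eq_adjoint, LinearMap.adjoint_inner_left] using e
  · have e : LinearMap.trace ℂ H (conjMap (U : H →ₗ[ℂ] H) ρ) = LinearMap.trace ℂ H ρ := by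
      change LinearMap.trace ℂ H ((U : H →ₗ[ℂ] H) * ρ * star (U : H →ₗ[ℂ] H)) = _
      rw [LinearMap.trace_mul_comm, ← mul_assoc, Unitary.coe_star_mul_self, one_mul]
    rw [e]

/-- The unitary channel `ρ ↦ U ρ U†`, as a quantum operation from a system to itself. -/
def unitaryChannel (U : unitary (H →ₗ[ℂ] H)) : Op H H :=
  ⟨conjMap (U : H →ₗ[ℂ] H), conjMap_mem_Op U⟩

/-- The transpose of an operator with respect to an orthonormal basis. -/
def transposeOp {ι : Type*} [Fintype ι] [DecidableEq ι] (b : OrthonormalBasis ι ℂ H)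
    (A : H →ₗ[ℂ] H) : H →ₗ[ℂ] H :=
  (LinearMap.toMatrixOrthonormal b).symm (LinearMap.toMatrixOrthonormal b A).transpose

theorem transposeOp_mem_unitary {ι : Type*} [Fintype ι] [DecidableEq ι]
    (b : OrthonormalBasis ι ℂ H) (U : unitary (H →ₗ[ℂ] H)) :
    transposeOp b (U : H →ₗ[ℂ] H) ∈ unitary (H →ₗ[ℂ] H) := by
  have h : LinearMap.toMatrixOrthonormal b (U : H →ₗ[ℂ] H) ∈ unitary (Matrix ι ι ℂ) :=
    Unitary.map_mem (LinearMap.toMatrixOrthonormal b) U.2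
  exact Unitary.map_mem (LinearMap.toMatrixOrthonormal b).symm
    (Matrix.transpose_mem_unitaryGroup_iff.mpr h)

/-- The transpose `Uᵀ` of a unitary operator `U` with respect to an orthonormal basis, as a unitary
operator. Its adjoint is the complex conjugate of `U`, so that its unitary channel is
`ρ ↦ Uᵀ ρ U*`. -/
def unitaryTranspose {ι : Type*} [Fintype ι] [DecidableEq ι] (b : OrthonormalBasis ι ℂ H)
    (U : unitary (H →ₗ[ℂ] H)) : unitary (H →ₗ[ℂ] H) :=
  ⟨transposeOp b (U : H →ₗ[ℂ] H), transposeOp_mem_unitary b U⟩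

end QuantumEvolution

end

/-!
Choi's isomorphism identifies completely positive maps with positive operators on the
Hilbert–Schmidt space `L(H)`; the atomic map `ρ ↦ K ρ K†` becomes the rank-one operator along `K`. A
symmetry `S` of `Op(H, H)` is additive where addition is defined, hence an order automorphism
(`OpSymmetry.le_iff_le`), and therefore maps atomic operations to atomic ones
(`OpSymmetry.exists_conjMap`).

Suppose `S` permutes the unitary channels by `U ↦ U†` or `U ↦ Uᵀ`. A uniform mixture of
clock-and-shift unitary channels has Choi operator proportional to the identity, and so has its
image (`exists_unitary_parseval`). The largest `r` for which `r · K(·)K†` lies below that mixture,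
or below a mixture of it with one more channel `V(·)V†`, is a function of `Tr[K†K]` and `|Tr[K†V]|`
(`isCompletelyPositive_sub_smul_conjMap_iff`). Hence these two numbers are preserved by `S`
(`OpSymmetry.norm_hs_eq`).

When `s` and `t` are real in the chosen basis, the image of `|s⟩⟨t|` thus has the same overlaps with
all unitaries as `|t⟩⟨s|`. Testing this on unitaries that multiply one direction by a phase shows
that the image is, up to a phase, `|t⟩⟨s|` itself or, in dimension two, an operator `|x⟩⟨w|` with `w`
orthogonal to `s`
(`exists_conjMap_eq_conjMap_ketBra`). For orthonormal `t, t'` the operation with Kraus operators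
`|s⟩⟨t|` and `|s⟩⟨t'|` is trace non-increasing, and so is its image. The input vectors of the two
image atoms are therefore orthogonal, and exactly one of them is `s`. In dimension at least three
this is already impossible; in every dimension it implies that the image operation sends `|s⟩⟨s|` to
`|t⟩⟨t|` or to `|t'⟩⟨t'|` (`OpSymmetry.apply_ketBra_self`). But the operation depends only on the
span of `t` and `t'`, so that rotating the pair by 45 degrees gives a contradiction
(`OpSymmetry.not_reverses`).
-/

noncomputable section

namespace QuantumEvolution

variable {H : Type*} [NormedAddCommGroup H] [InnerProductSpace ℂ H] [FiniteDimensional ℂ H]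

/-! ### The Hilbert–Schmidt inner product -/

/-- The operator `|x⟩⟨y|`, that is, `z ↦ ⟪y, z⟫ x`. -/
def ketBra (x y : H) : H →ₗ[ℂ] H := (InnerProductSpace.rankOne ℂ x y : H →L[ℂ] H)

omit [FiniteDimensional ℂ H] in
@[simp]
theorem ketBra_apply (x y z : H) : ketBra x y z = ⟪y, z⟫_ℂ • x := rfl

/-- The Hilbert–Schmidt inner product `Tr[X† Y]`. -/
def hs (X Y : H →ₗ[ℂ] H) : ℂ := LinearMap.trace ℂ H (star X * Y)

theorem hs_eq_sum {ι : Type*} [Fintype ι] (b : OrthonormalBasis ι ℂ H) (X Y : H →ₗ[ℂ] H) :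
    hs X Y = ∑ i, ⟪X (b i), Y (b i)⟫_ℂ := by
  rw [hs, LinearMap.trace_eq_sum_inner _ b]
  simp [LinearMap.star_eq_adjoint, LinearMap.adjoint_inner_right]

theorem hs_conj_symm (X Y : H →ₗ[ℂ] H) : starRingEnd ℂ (hs Y X) = hs X Y := by
  simp [hs_eq_sum (stdOrthonormalBasis ℂ H), map_sum, inner_conj_symm]

theorem norm_hs_comm (X Y : H →ₗ[ℂ] H) : ‖hs X Y‖ = ‖hs Y X‖ := by
  rw [← hs_conj_symm, RCLike.norm_conj]

/-- The Hilbert–Schmidt inner product on `L(H)`, as a core from which the Hilbert space structure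
of `L(H)` is built where it is needed. -/
@[reducible]
def hsCore : InnerProductSpace.Core ℂ (H →ₗ[ℂ] H) where
  inner := hs
  conj_inner_symm X Y := hs_conj_symm X Y
  re_inner_nonneg X := by
    rw [hs_eq_sum (stdOrthonormalBasis ℂ H), map_sum]
    exact Finset.sum_nonneg fun i _ => inner_self_nonneg
  add_left X Y Z := by simp [hs, add_mul]
  smul_left X Y c := by simp [hs]
  definite X h := by
    rw [hs_eq_sum (stdOrthonormalBasis ℂ H)] at h
    have h0 := (Finset.sum_eq_zero_iff_of_nonneg fun i _ => inner_self_nonneg (𝕜 := ℂ)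
      (x := X (stdOrthonormalBasis ℂ H i))).1 (by simpa using congrArg Complex.re h)
    refine (stdOrthonormalBasis ℂ H).toBasis.ext fun i => ?_
    have := h0 i (Finset.mem_univ i)
    rw [inner_self_eq_norm_sq] at this
    simpa using this

theorem hs_add_right (X Y Z : H →ₗ[ℂ] H) : hs X (Y + Z) = hs X Y + hs X Z := by
  simp [hs, mul_add]

theorem hs_sub_right (X Y Z : H →ₗ[ℂ] H) : hs X (Y - Z) = hs X Y - hs X Z := by
  simp [hs, mul_sub]

theorem hs_smul_right (c : ℂ) (X Y : H →ₗ[ℂ] H) : hs X (c • Y) = c * hs X Y := by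
  simp [hs]

theorem hs_sub_left (X Y Z : H →ₗ[ℂ] H) : hs (X - Y) Z = hs X Z - hs Y Z := by
  simp [hs, sub_mul]

theorem hs_smul_left (c : ℂ) (X Y : H →ₗ[ℂ] H) :
    hs (c • X) Y = starRingEnd ℂ c * hs X Y := by
  simp [hs]

theorem hs_mul_right (X V W : H →ₗ[ℂ] H) : hs X (V * W) = hs (star V * X) W := by
  simp [hs, mul_assoc]

theorem hs_self_eq_zero {X : H →ₗ[ℂ] H} : hs X X = 0 ↔ X = 0 :=
  ⟨hsCore.definite X, fun h => by simp [h, hs]⟩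

theorem hs_self_nonneg (X : H →ₗ[ℂ] H) : 0 ≤ hs X X := by
  rw [hs_eq_sum (stdOrthonormalBasis ℂ H)]
  refine Finset.sum_nonneg fun i _ => ?_
  rw [inner_self_eq_norm_sq_to_K]
  exact pow_nonneg (Complex.zero_le_real.2 (norm_nonneg (X _))) 2

/-- The squared Hilbert–Schmidt norm is real, so it may be read off from its modulus. -/
theorem hs_self_eq_norm (X : H →ₗ[ℂ] H) : hs X X = (‖hs X X‖ : ℂ) :=
  Complex.eq_coe_norm_of_nonneg (hs_self_nonneg X)

theorem hs_ketBra_left (x y : H) (Y : H →ₗ[ℂ] H) : hs (ketBra x y) Y = ⟪x, Y y⟫_ℂ := by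
  have e := (stdOrthonormalBasis ℂ H).sum_repr' y
  conv_rhs => rw [← e]
  simp [hs_eq_sum (stdOrthonormalBasis ℂ H), mul_comm]

theorem hs_ketBra_right (x y : H) (Y : H →ₗ[ℂ] H) : hs Y (ketBra x y) = ⟪Y y, x⟫_ℂ := by
  rw [← hs_conj_symm, hs_ketBra_left, inner_conj_symm]

/-! ### Choi's criterion and Kraus decompositions -/

theorem conjMap_ketBra (K : H →ₗ[ℂ] H) (x y : H) :
    conjMap K (ketBra x y) = ketBra (K x) (K y) := by
  ext z
  simp [conjMap, LinearMap.star_eq_adjoint, LinearMap.adjoint_inner_right]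

theorem conjMap_smul (c : ℂ) (K : H →ₗ[ℂ] H) :
    conjMap (c • K) = ((‖c‖ ^ 2 : ℝ) : ℂ) • conjMap K := by
  ext ρ x
  simp [conjMap, smul_smul, ← Complex.conj_mul']

/-- The quadratic form of the Choi operator of `Q`, evaluated at the vector of `H ⊗ H` that
corresponds to `X ∈ L(H)`. -/
def choiForm (Q : (H →ₗ[ℂ] H) →ₗ[ℂ] (H →ₗ[ℂ] H)) (X : H →ₗ[ℂ] H) : ℂ :=
  ∑ i, ∑ j, ⟪X (stdOrthonormalBasis ℂ H i),
    Q (ketBra (stdOrthonormalBasis ℂ H i) (stdOrthonormalBasis ℂ H j))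
      (X (stdOrthonormalBasis ℂ H j))⟫_ℂ

theorem choiForm_add (Q R : (H →ₗ[ℂ] H) →ₗ[ℂ] (H →ₗ[ℂ] H)) (X : H →ₗ[ℂ] H) :
    choiForm (Q + R) X = choiForm Q X + choiForm R X := by
  simp [choiForm, Finset.sum_add_distrib]

theorem choiForm_sub (Q R : (H →ₗ[ℂ] H) →ₗ[ℂ] (H →ₗ[ℂ] H)) (X : H →ₗ[ℂ] H) :
    choiForm (Q - R) X = choiForm Q X - choiForm R X := by
  simp [choiForm, Finset.sum_sub_distrib]

theorem choiForm_smul (c : ℂ) (Q : (H →ₗ[ℂ] H) →ₗ[ℂ] (H →ₗ[ℂ] H)) (X : H →ₗ[ℂ] H) :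
    choiForm (c • Q) X = c * choiForm Q X := by
  simp [choiForm, Finset.mul_sum]

theorem choiForm_sum {ι : Type*} (s : Finset ι) (Q : ι → (H →ₗ[ℂ] H) →ₗ[ℂ] (H →ₗ[ℂ] H))
    (X : H →ₗ[ℂ] H) : choiForm (∑ m ∈ s, Q m) X = ∑ m ∈ s, choiForm (Q m) X := by
  classical
  induction s using Finset.induction_on with
  | empty => simp [choiForm]
  | insert a s ha ih => rw [Finset.sum_insert ha, choiForm_add, ih, Finset.sum_insert ha]

/-- The Choi operator of `ρ ↦ K ρ K†` is the rank-one operator along `K`. -/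
theorem choiForm_conjMap (K X : H →ₗ[ℂ] H) :
    choiForm (conjMap K) X = ((‖hs K X‖ ^ 2 : ℝ) : ℂ) := by
  have h : choiForm (conjMap K) X = hs X K * hs K X := by
    simp only [choiForm, conjMap_ketBra, ketBra_apply, inner_smul_right,
      hs_eq_sum (stdOrthonormalBasis ℂ H), Finset.sum_mul_sum]
    exact Finset.sum_congr rfl fun i _ => Finset.sum_congr rfl fun j _ => mul_comm _ _
  rw [h, ← hs_conj_symm X K, Complex.conj_mul', Complex.ofReal_pow]

theorem isCompletelyPositive_conjMap (K : H →ₗ[ℂ] H) : IsCompletelyPositive (conjMap K) := by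
  intro k A hA x
  have e := hA (fun i => (star K) (x i))
  simpa [conjMap, LinearMap.star_eq_adjoint, LinearMap.adjoint_inner_left] using e

omit [FiniteDimensional ℂ H] in
theorem IsCompletelyPositive.add {Q R : (H →ₗ[ℂ] H) →ₗ[ℂ] (H →ₗ[ℂ] H)}
    (hQ : IsCompletelyPositive Q) (hR : IsCompletelyPositive R) :
    IsCompletelyPositive (Q + R) := by
  intro k A hA x
  simpa [inner_add_right, Finset.sum_add_distrib] using add_nonneg (hQ k A hA x) (hR k A hA x)

omit [FiniteDimensional ℂ H] in
theorem IsCompletelyPositive.sum {ι : Type*} {s : Finset ι}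
    {Q : ι → (H →ₗ[ℂ] H) →ₗ[ℂ] (H →ₗ[ℂ] H)} (h : ∀ m ∈ s, IsCompletelyPositive (Q m)) :
    IsCompletelyPositive (∑ m ∈ s, Q m) := by
  classical
  induction s using Finset.induction_on with
  | empty => exact fun k A _ x => by simp
  | insert a s ha ih =>
    rw [Finset.sum_insert ha]
    exact (h a (Finset.mem_insert_self a s)).add
      (ih fun m hm => h m (Finset.mem_insert_of_mem hm))

theorem IsCompletelyPositive.choiForm_nonneg {Q : (H →ₗ[ℂ] H) →ₗ[ℂ] (H →ₗ[ℂ] H)}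
    (hQ : IsCompletelyPositive Q) (X : H →ₗ[ℂ] H) : 0 ≤ choiForm Q X := by
  refine hQ _ (fun i j => ketBra (stdOrthonormalBasis ℂ H i) (stdOrthonormalBasis ℂ H j))
    (fun x => ?_) (fun i => X (stdOrthonormalBasis ℂ H i))
  have e : ∑ i, ∑ j, ⟪x i, ketBra (stdOrthonormalBasis ℂ H i) (stdOrthonormalBasis ℂ H j) (x j)⟫_ℂ
      = star (∑ i, ⟪stdOrthonormalBasis ℂ H i, x i⟫_ℂ) *
        ∑ i, ⟪stdOrthonormalBasis ℂ H i, x i⟫_ℂ := by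
    simp only [star_sum, Finset.sum_mul_sum, ketBra_apply, inner_smul_right]
    refine Finset.sum_congr rfl fun i _ => Finset.sum_congr rfl fun j _ => ?_
    rw [mul_comm]
    congr 1
    exact (inner_conj_symm _ _).symm
  rw [e]
  exact star_mul_self_nonneg _

/-- Over `ℂ`, hermiticity need not be assumed: a matrix with nonnegative quadratic form is positive
semidefinite. -/
theorem posSemidef_of_quadratic_nonneg {n : Type*} [Fintype n] [DecidableEq n]
    {A : Matrix n n ℂ} (h : ∀ x : n → ℂ, 0 ≤ star x ⬝ᵥ A.mulVec x) : A.PosSemidef := by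
  rw [← Matrix.isPositive_toEuclideanLin_iff, LinearMap.isPositive_iff_complex]
  intro x
  have e : ⟪Matrix.toEuclideanLin A x, x⟫_ℂ = star (star x.ofLp ⬝ᵥ A.mulVec x.ofLp) := by
    rw [← inner_conj_symm, EuclideanSpace.inner_eq_star_dotProduct, dotProduct_comm]
    simp [Matrix.toLpLin_apply]
  have h0 := h x.ofLp
  rw [e, (IsSelfAdjoint.of_nonneg h0).star_eq]
  exact ⟨(Complex.eq_re_of_ofReal_le h0).symm, (Complex.le_def.1 h0).1⟩

omit [FiniteDimensional ℂ H] in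
theorem eq_sum_ketBra {ι : Type*} [Fintype ι] (b : OrthonormalBasis ι ℂ H) (ρ : H →ₗ[ℂ] H) :
    ρ = ∑ i, ∑ j, ⟪b i, ρ (b j)⟫_ℂ • ketBra (b i) (b j) := by
  classical
  refine b.toBasis.ext fun k => ?_
  simp only [LinearMap.sum_apply, OrthonormalBasis.coe_toBasis, LinearMap.smul_apply,
    ketBra_apply, b.inner_eq_ite, ite_smul, one_smul, zero_smul, smul_ite, smul_zero,
    Finset.sum_ite_eq', Finset.mem_univ, if_true]
  exact (b.sum_repr' _).symm

/-- A map whose Choi form is nonnegative is a sum of maps `ρ ↦ K ρ K†`. -/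
theorem exists_kraus {Q : (H →ₗ[ℂ] H) →ₗ[ℂ] (H →ₗ[ℂ] H)} (hQ : ∀ X, 0 ≤ choiForm Q X) :
    ∃ (m : ℕ) (K : Fin m → (H →ₗ[ℂ] H)), Q = ∑ i, conjMap (K i) := by
  classical
  set e := stdOrthonormalBasis ℂ H with he
  let V (x : Fin (Module.finrank ℂ H) × Fin (Module.finrank ℂ H) → ℂ) : H →ₗ[ℂ] H :=
    e.toBasis.constr ℂ fun i => ∑ a, x (a, i) • e a
  have hV : ∀ x i, V x (e i) = ∑ a, x (a, i) • e a := fun x i => by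
    have := e.toBasis.constr_basis ℂ (fun i => ∑ a, x (a, i) • e a) i
    rwa [OrthonormalBasis.coe_toBasis] at this
  have hV' : ∀ x a i, ⟪e a, V x (e i)⟫_ℂ = x (a, i) := fun x a i => by
    simp [hV, e.inner_eq_ite]
  let C : Matrix (Fin (Module.finrank ℂ H) × Fin (Module.finrank ℂ H))
      (Fin (Module.finrank ℂ H) × Fin (Module.finrank ℂ H)) ℂ :=
    fun p q => ⟪e p.1, Q (ketBra (e p.2) (e q.2)) (e q.1)⟫_ℂ
  have hC : C.PosSemidef := by
    refine posSemidef_of_quadratic_nonneg fun x => ?_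
    have h := hQ (V x)
    simp only [choiForm, ← he, hV] at h
    convert h using 1
    simp only [dotProduct, Matrix.mulVec, Fintype.sum_prod_type_right, map_sum, map_smul, sum_inner,
      inner_sum, inner_smul_left, inner_smul_right, Finset.mul_sum, C, Pi.star_apply]
    refine Finset.sum_congr rfl fun i _ => ?_
    rw [Finset.sum_comm]
    refine Finset.sum_congr rfl fun j _ => ?_
    rw [Finset.sum_comm]
    refine Finset.sum_congr rfl fun a _ => Finset.sum_congr rfl fun b _ => ?_
    simp only [RCLike.star_def]
    ring
  obtain ⟨m, B, hB⟩ := Matrix.posSemidef_iff_eq_sum_vecMulVec.1 hC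
  refine ⟨m, fun k => V (B k), LinearMap.ext fun ρ => ?_⟩
  rw [eq_sum_ketBra e ρ]
  simp only [map_sum, map_smul]
  refine Finset.sum_congr rfl fun i _ => Finset.sum_congr rfl fun j _ => congrArg _ ?_
  refine e.toBasis.ext fun b => InnerProductSpace.ext_inner_left_basis e.toBasis fun a => ?_
  have hab : C (a, i) (b, j) = _ := congrFun (congrFun hB (a, i)) (b, j)
  simp only [OrthonormalBasis.coe_toBasis, LinearMap.sum_apply, conjMap_ketBra, ketBra_apply,
    inner_sum, inner_smul_right, hV']
  refine hab.trans ?_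
  simp only [Matrix.sum_apply, Matrix.vecMulVec_apply, Pi.star_apply]
  refine Finset.sum_congr rfl fun k _ => ?_
  rw [← inner_conj_symm, hV', mul_comm]
  rfl

theorem isCompletelyPositive_iff {Q : (H →ₗ[ℂ] H) →ₗ[ℂ] (H →ₗ[ℂ] H)} :
    IsCompletelyPositive Q ↔ ∀ X, 0 ≤ choiForm Q X := by
  refine ⟨fun h => h.choiForm_nonneg, fun h => ?_⟩
  obtain ⟨m, K, rfl⟩ := exists_kraus h
  exact IsCompletelyPositive.sum fun i _ => isCompletelyPositive_conjMap (K i)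

/-! ### Order and symmetries of the set of quantum operations -/

omit [FiniteDimensional ℂ H] in
theorem IsCompletelyPositive.smul {Q : (H →ₗ[ℂ] H) →ₗ[ℂ] (H →ₗ[ℂ] H)}
    (hQ : IsCompletelyPositive Q) {p : ℝ} (hp : 0 ≤ p) :
    IsCompletelyPositive ((p : ℂ) • Q) := by
  intro k A hA x
  simpa [inner_smul_right, Finset.mul_sum] using
    mul_nonneg (Complex.zero_le_real.2 hp) (hQ k A hA x)

theorem IsCompletelyPositive.trace_nonneg {Q : (H →ₗ[ℂ] H) →ₗ[ℂ] (H →ₗ[ℂ] H)}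
    (hQ : IsCompletelyPositive Q) {ρ : H →ₗ[ℂ] H} (hρ : ρ.IsPositive) :
    0 ≤ (LinearMap.trace ℂ H (Q ρ)).re := by
  rw [LinearMap.trace_eq_sum_inner _ (stdOrthonormalBasis ℂ H), Complex.re_sum]
  refine Finset.sum_nonneg fun i _ => ?_
  have h := hQ 1 (fun _ _ => ρ) (fun x => by simpa using hρ.inner_nonneg_right (x 0))
    (fun _ => stdOrthonormalBasis ℂ H i)
  simpa using (Complex.le_def.1 h).1

/-- `Op(H, H)` is a lower set for the order given by complete positivity of the difference. -/
theorem mem_Op_of_le {Q R : (H →ₗ[ℂ] H) →ₗ[ℂ] (H →ₗ[ℂ] H)} (hQ : IsCompletelyPositive Q)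
    (h : IsCompletelyPositive (R - Q)) (hR : R ∈ Op H H) : Q ∈ Op H H := by
  refine ⟨hQ, fun ρ hρ => ?_⟩
  have h1 := h.trace_nonneg hρ
  have h2 := hR.2 ρ hρ
  simp only [LinearMap.sub_apply, map_sub, Complex.sub_re] at h1
  linarith

theorem smul_mem_Op {Q : (H →ₗ[ℂ] H) →ₗ[ℂ] (H →ₗ[ℂ] H)} (hQ : Q ∈ Op H H) {p : ℝ}
    (hp : p ∈ Set.Icc (0 : ℝ) 1) : (p : ℂ) • Q ∈ Op H H := by
  simpa using mix_mem_Op hQ (zero_mem_Op (Hin := H) (Hout := H)) hp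

namespace OpSymmetry

variable (S : OpSymmetry H H H H)

theorem map_smul {Q T : Op H H} {p : ℝ} (hp : p ∈ Set.Icc (0 : ℝ) 1)
    (h : T.1 = (p : ℂ) • Q.1) : (S.toFun T).1 = (p : ℂ) • (S.toFun Q).1 := by
  have e : T = Op.mix p hp Q Op.null := Subtype.ext (by simp [Op.mix, Op.null, h])
  rw [e, S.map_mix, S.map_null]
  simp [Op.mix, Op.null]

/-- A symmetry is additive: half of `Q + R` is at once a mixture of `Q + R` with `0` and one of `Q`
with `R`. -/
theorem map_add {Q R T : Op H H} (h : T.1 = Q.1 + R.1) :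
    (S.toFun T).1 = (S.toFun Q).1 + (S.toFun R).1 := by
  have hp : (1 / 2 : ℝ) ∈ Set.Icc (0 : ℝ) 1 := by norm_num
  have e : Op.mix (1 / 2) hp Q R = Op.mix (1 / 2) hp T Op.null := Subtype.ext <| by
    simp only [Op.mix, Op.null, h]
    norm_num
  have e2 := congrArg S.toFun e
  rw [S.map_mix, S.map_mix, S.map_null] at e2
  have e3 := congrArg (fun Z => (2 : ℂ) • Z.1) e2
  simpa [Op.mix, Op.null, smul_smul, show (1 : ℂ) - 2⁻¹ = 2⁻¹ by norm_num] using e3.symm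

/-- The inverse of a symmetry. -/
def symm : OpSymmetry H H H H where
  toFun := (Equiv.ofBijective S.toFun S.bijective).symm
  bijective := (Equiv.ofBijective S.toFun S.bijective).symm.bijective
  map_mix p hp Q R := by
    rw [Equiv.symm_apply_eq, Equiv.ofBijective_apply, S.map_mix]
    simp only [Equiv.ofBijective_apply_symm_apply]
  map_null := by
    rw [Equiv.symm_apply_eq, Equiv.ofBijective_apply, S.map_null]

@[simp]
theorem symm_apply (Q : Op H H) : S.symm.toFun (S.toFun Q) = Q :=
  Equiv.ofBijective_symm_apply_apply S.toFun S.bijective Q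

@[simp]
theorem apply_symm (Q : Op H H) : S.toFun (S.symm.toFun Q) = Q :=
  Equiv.ofBijective_apply_symm_apply S.toFun S.bijective Q

theorem monotone {Q R : Op H H} (h : IsCompletelyPositive (R.1 - Q.1)) :
    IsCompletelyPositive ((S.toFun R).1 - (S.toFun Q).1) := by
  let D : Op H H := ⟨R.1 - Q.1, mem_Op_of_le h (by simpa using Q.2.1) R.2⟩
  have e : (S.toFun R).1 = (S.toFun Q).1 + (S.toFun D).1 := S.map_add (by simp [D])
  rw [e, add_sub_cancel_left]
  exact (S.toFun D).2.1

theorem le_iff_le {Q R : Op H H} : IsCompletelyPositive ((S.toFun R).1 - (S.toFun Q).1) ↔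
    IsCompletelyPositive (R.1 - Q.1) :=
  ⟨fun h => by simpa using S.symm.monotone h, S.monotone⟩

theorem map_sum {ι : Type*} (s : Finset ι) (Q : ι → Op H H) :
    ∀ {T : Op H H}, T.1 = ∑ m ∈ s, (Q m).1 → (S.toFun T).1 = ∑ m ∈ s, (S.toFun (Q m)).1 := by
  classical
  induction s using Finset.induction_on with
  | empty =>
    intro T hT
    have e : T = Op.null := Subtype.ext (by simpa [Op.null] using hT)
    rw [e, S.map_null]
    simp [Op.null]
  | insert a s ha ih =>
    intro T hT
    rw [Finset.sum_insert ha] at hT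
    let R : Op H H := ⟨∑ m ∈ s, (Q m).1, mem_Op_of_le
      (IsCompletelyPositive.sum fun m _ => (Q m).2.1)
      (by rw [hT, add_sub_cancel_right]; exact (Q a).2.1) T.2⟩
    rw [Finset.sum_insert ha, S.map_add (Q := Q a) (R := R) hT, ih (T := R) rfl]

end OpSymmetry

/-- If `L` is orthogonal to everything `K` is orthogonal to, then `L` is a multiple of `K`. -/
theorem exists_eq_smul_of_hs {K L : H →ₗ[ℂ] H} (hK : K ≠ 0)
    (h : ∀ X, hs K X = 0 → hs L X = 0) : ∃ c : ℂ, L = c • K := by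
  have h0 : hs K K ≠ 0 := fun h => hK (hs_self_eq_zero.1 h)
  refine ⟨hs K L / hs K K, ?_⟩
  rw [← sub_eq_zero, ← hs_self_eq_zero, hs_sub_left, hs_smul_left, h, mul_eq_zero_of_right,
    sub_zero]
  all_goals rw [hs_sub_right, hs_smul_right, div_mul_cancel₀ _ h0, sub_self]

/-- The operation `ρ ↦ K ρ K†` is atomic: a completely positive map below it is proportional
to it. -/
theorem eq_smul_conjMap_of_le {K : H →ₗ[ℂ] H} (hK : K ≠ 0)
    {R : (H →ₗ[ℂ] H) →ₗ[ℂ] (H →ₗ[ℂ] H)} (hR : IsCompletelyPositive R)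
    (h : IsCompletelyPositive (conjMap K - R)) :
    ∃ p ∈ Set.Icc (0 : ℝ) 1, R = (p : ℂ) • conjMap K := by
  obtain ⟨m, L, rfl⟩ := exists_kraus hR.choiForm_nonneg
  have hle : ∀ X, ∑ i, ‖hs (L i) X‖ ^ 2 ≤ ‖hs K X‖ ^ 2 := fun X => by
    have := h.choiForm_nonneg X
    simp only [choiForm_sub, choiForm_sum, choiForm_conjMap, sub_nonneg] at this
    exact_mod_cast this
  have hL : ∀ i, ∃ c : ℂ, L i = c • K := fun i => exists_eq_smul_of_hs hK fun X hX => by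
    have h1 := hle X
    rw [hX, norm_zero, zero_pow two_ne_zero] at h1
    have h2 := (Finset.sum_eq_zero_iff_of_nonneg fun i _ => sq_nonneg _).1
      (le_antisymm h1 (Finset.sum_nonneg fun i _ => sq_nonneg ‖hs (L i) X‖)) i (Finset.mem_univ i)
    simpa using h2
  choose c hc using hL
  refine ⟨∑ i, ‖c i‖ ^ 2, ⟨Finset.sum_nonneg fun i _ => sq_nonneg _, ?_⟩, ?_⟩
  · have h1 := hle K
    have h0 : 0 < ‖hs K K‖ ^ 2 := by
      have : hs K K ≠ 0 := fun h => hK (hs_self_eq_zero.1 h)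
      positivity
    simp only [hc, hs_smul_left, norm_mul, mul_pow, RCLike.norm_conj, ← Finset.sum_mul] at h1
    exact (mul_le_iff_le_one_left h0).1 h1
  · simp only [hc, conjMap_smul, ← Finset.sum_smul]
    push_cast
    rfl

theorem conjMap_eq_zero_iff {K : H →ₗ[ℂ] H} : conjMap K = 0 ↔ K = 0 := by
  refine ⟨fun h => ?_, fun h => ?_⟩
  · have := choiForm_conjMap K K
    rw [h] at this
    simpa [choiForm, hs_self_eq_zero] using this.symm
  · ext; simp [h, conjMap]

/-- A symmetry maps atomic operations to atomic operations. -/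
theorem OpSymmetry.exists_conjMap (S : OpSymmetry H H H H) {Q : Op H H} {K : H →ₗ[ℂ] H}
    (hK : K ≠ 0) (hQ : Q.1 = conjMap K) : ∃ K', (S.toFun Q).1 = conjMap K' := by
  obtain ⟨m, L, hL⟩ := exists_kraus (S.toFun Q).2.1.choiForm_nonneg
  by_cases h0 : ∀ i, L i = 0
  · exact ⟨0, by rw [hL, conjMap_eq_zero_iff.2 rfl]
                 exact Finset.sum_eq_zero fun i _ => conjMap_eq_zero_iff.2 (h0 i)⟩
  · push Not at h0
    obtain ⟨i, hi⟩ := h0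
    have hle : IsCompletelyPositive ((S.toFun Q).1 - conjMap (L i)) := by
      rw [hL, ← Finset.add_sum_erase _ _ (Finset.mem_univ i), add_sub_cancel_left]
      exact IsCompletelyPositive.sum fun j _ => isCompletelyPositive_conjMap (L j)
    let T : Op H H := ⟨conjMap (L i), mem_Op_of_le (isCompletelyPositive_conjMap _) hle
      (S.toFun Q).2⟩
    have hT := S.symm.monotone (Q := T) hle
    rw [S.symm_apply, hQ] at hT
    obtain ⟨p, hp, hpT⟩ := eq_smul_conjMap_of_le hK (S.symm.toFun T).2.1 hT
    rw [← hQ] at hpT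
    have hST := S.map_smul hp hpT
    rw [S.apply_symm] at hST
    have hp0 : p ≠ 0 := fun h => hi (conjMap_eq_zero_iff.1 (by simpa [h] using hST))
    refine ⟨(((√p)⁻¹ : ℝ) : ℂ) • L i, ?_⟩
    have hn : ‖(((√p)⁻¹ : ℝ) : ℂ)‖ ^ 2 = p⁻¹ := by
      rw [Complex.norm_real, Real.norm_eq_abs, sq_abs, inv_pow, Real.sq_sqrt hp.1]
    have hST' : conjMap (L i) = (p : ℂ) • (S.toFun Q).1 := hST
    rw [conjMap_smul, hn, hST', smul_smul, ← Complex.ofReal_mul, inv_mul_cancel₀ hp0,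
      Complex.ofReal_one, one_smul]

/-! ### Hilbert–Schmidt overlaps as order thresholds -/

/-- The form `λ |⟪k, x⟫|²` is dominated by `‖x‖² + |⟪u, x⟫|²` exactly when
`λ ⟪k, (1 + |u⟩⟨u|)⁻¹ k⟫ ≤ 1`. -/
theorem forall_mul_norm_inner_sq_le_iff {E : Type*} [NormedAddCommGroup E] [InnerProductSpace ℂ E]
    (k u : E) {r : ℝ} (hr : 0 ≤ r) :
    (∀ x, r * ‖⟪k, x⟫_ℂ‖ ^ 2 ≤ ‖x‖ ^ 2 + ‖⟪u, x⟫_ℂ‖ ^ 2) ↔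
      r * (‖k‖ ^ 2 - ‖⟪k, u⟫_ℂ‖ ^ 2 / (1 + ‖u‖ ^ 2)) ≤ 1 := by
  have hu : (1 + (‖u‖ : ℂ) ^ 2) ≠ 0 := by
    have : (0 : ℝ) < 1 + ‖u‖ ^ 2 := by positivity
    exact_mod_cast this.ne'
  -- `a = (1 + |u⟩⟨u|)⁻¹ k`
  set a : E := k - (⟪u, k⟫_ℂ / (1 + (‖u‖ : ℂ) ^ 2)) • u with ha
  have hua : ⟪u, a⟫_ℂ = ⟪u, k⟫_ℂ / (1 + (‖u‖ : ℂ) ^ 2) := by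
    rw [ha, inner_sub_right, inner_smul_right, inner_self_eq_norm_sq_to_K]
    field_simp
    simp
  have hk : k = a + ⟪u, a⟫_ℂ • u := by rw [hua, ha]; simp
  set β : ℝ := ‖k‖ ^ 2 - ‖⟪k, u⟫_ℂ‖ ^ 2 / (1 + ‖u‖ ^ 2) with hβ
  have hka : ⟪k, a⟫_ℂ = (β : ℂ) := by
    rw [ha, inner_sub_right, inner_smul_right, inner_self_eq_norm_sq_to_K, hβ]
    push_cast
    rw [← Complex.mul_conj', inner_conj_symm]
    simp
    ring
  have hform : ‖a‖ ^ 2 + ‖⟪u, a⟫_ℂ‖ ^ 2 = β := by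
    have h1 : ⟪k, a⟫_ℂ = ((‖a‖ ^ 2 + ‖⟪u, a⟫_ℂ‖ ^ 2 : ℝ) : ℂ) := by
      conv_lhs => rw [hk]
      rw [inner_add_left, inner_smul_left, inner_self_eq_norm_sq_to_K, Complex.conj_mul']
      simp
    exact_mod_cast (h1.symm.trans hka)
  constructor
  · intro h
    have h1 := h a
    rw [hform, hka, Complex.norm_real, Real.norm_eq_abs, sq_abs] at h1
    have hβ0 : 0 ≤ β := by rw [← hform]; positivity
    rcases hβ0.eq_or_lt with h0 | h0
    · rw [← h0]; simp
    · by_contra hc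
      push Not at hc
      nlinarith
  · intro h x
    have h1 : ‖⟪k, x⟫_ℂ‖ ≤ ‖a‖ * ‖x‖ + ‖⟪u, a⟫_ℂ‖ * ‖⟪u, x⟫_ℂ‖ := by
      conv_lhs => rw [hk]
      rw [inner_add_left, inner_smul_left]
      refine (norm_add_le _ _).trans (add_le_add (norm_inner_le_norm _ _) ?_)
      rw [norm_mul, RCLike.norm_conj]
    have h2 : ‖⟪k, x⟫_ℂ‖ ^ 2 ≤ β * (‖x‖ ^ 2 + ‖⟪u, x⟫_ℂ‖ ^ 2) := by
      rw [← hform]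
      refine (pow_le_pow_left₀ (norm_nonneg _) h1 2).trans ?_
      nlinarith [sq_nonneg (‖a‖ * ‖⟪u, x⟫_ℂ‖ - ‖⟪u, a⟫_ℂ‖ * ‖x‖)]
    have h3 : 0 ≤ ‖x‖ ^ 2 + ‖⟪u, x⟫_ℂ‖ ^ 2 := by positivity
    nlinarith [mul_le_mul_of_nonneg_left h2 hr, mul_le_mul_of_nonneg_right h h3]

theorem forall_mul_norm_hs_sq_le_iff (K U : H →ₗ[ℂ] H) {r : ℝ} (hr : 0 ≤ r) :
    (∀ X, r * ‖hs K X‖ ^ 2 ≤ ‖hs X X‖ + ‖hs U X‖ ^ 2) ↔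
      r * (‖hs K K‖ - ‖hs K U‖ ^ 2 / (1 + ‖hs U U‖)) ≤ 1 := by
  let _ : NormedAddCommGroup (H →ₗ[ℂ] H) := (hsCore (H := H)).toNormedAddCommGroup
  let _ : InnerProductSpace ℂ (H →ₗ[ℂ] H) := InnerProductSpace.ofCore _
  have hn : ∀ X : H →ₗ[ℂ] H, ‖hs X X‖ = ‖X‖ ^ 2 := fun X => by
    have : hs X X = ((‖X‖ ^ 2 : ℝ) : ℂ) := by
      have := inner_self_eq_norm_sq_to_K (𝕜 := ℂ) X
      push_cast
      exact this
    rw [this, Complex.norm_real, Real.norm_eq_abs, abs_of_nonneg (sq_nonneg _)]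
  have h := forall_mul_norm_inner_sq_le_iff (E := H →ₗ[ℂ] H) K U hr
  simp only [hn]
  exact h

/-! ### A unitary operator basis -/

theorem exists_unitary_apply {ι : Type*} [Fintype ι] (b : OrthonormalBasis ι ℂ H) {v : ι → H}
    (hv : Orthonormal ℂ v) : ∃ U : unitary (H →ₗ[ℂ] H), ∀ i, (U : H →ₗ[ℂ] H) (b i) = v i := by
  classical
  let U : H →ₗ[ℂ] H := b.toBasis.constr ℂ v
  have hU : ∀ i, U (b i) = v i := fun i => by
    have := b.toBasis.constr_basis ℂ v i
    rwa [OrthonormalBasis.coe_toBasis] at this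
  have h1 : star U * U = 1 := by
    refine b.toBasis.ext fun j => InnerProductSpace.ext_inner_left_basis b.toBasis fun i => ?_
    simp [LinearMap.star_eq_adjoint, LinearMap.adjoint_inner_right, hU, b.inner_eq_ite,
      orthonormal_iff_ite.1 hv]
  exact ⟨⟨U, Unitary.mem_iff.2 ⟨h1, mul_eq_one_comm.1 h1⟩⟩, hU⟩

theorem sum_norm_sq_stdAddChar {n : ℕ} [NeZero n] (z : ZMod n → ℂ) :
    ∑ a : ZMod n, ‖∑ j, ZMod.stdAddChar (a * j) * z j‖ ^ 2 = n * ∑ j, ‖z j‖ ^ 2 := by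
  have key : ∑ a : ZMod n, (∑ j, ZMod.stdAddChar (a * j) * z j) *
      starRingEnd ℂ (∑ j, ZMod.stdAddChar (a * j) * z j) = n * ∑ j, z j * starRingEnd ℂ (z j) := by
    have hc : ∀ x : ZMod n, starRingEnd ℂ (ZMod.stdAddChar x) = ZMod.stdAddChar (-x) := fun x => by
      rw [ZMod.stdAddChar_apply, ZMod.stdAddChar_apply, ← Circle.coe_inv_eq_conj,
        AddChar.map_neg_eq_inv]
    simp only [map_sum, map_mul, hc, Finset.sum_mul_sum]
    rw [Finset.sum_comm, Finset.mul_sum]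
    refine Finset.sum_congr rfl fun j _ => ?_
    rw [Finset.sum_comm]
    have h2 : ∀ k, ∑ a : ZMod n, ZMod.stdAddChar (a * j) * z j *
        (ZMod.stdAddChar (-(a * k)) * starRingEnd ℂ (z k)) =
        (if j - k = 0 then (n : ℂ) else 0) * (z j * starRingEnd ℂ (z k)) := fun k => by
      have h3 := AddChar.sum_mulShift (j - k) (ZMod.isPrimitive_stdAddChar n)
      rw [ZMod.card] at h3
      push_cast at h3
      rw [← h3, Finset.sum_mul]
      refine Finset.sum_congr rfl fun a _ => ?_
      rw [mul_sub, sub_eq_add_neg, AddChar.map_add_eq_mul]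
      ring
    simp [h2, sub_eq_zero]
  have h : ((∑ a : ZMod n, ‖∑ j, ZMod.stdAddChar (a * j) * z j‖ ^ 2 : ℝ) : ℂ) =
      ((n * ∑ j, ‖z j‖ ^ 2 : ℝ) : ℂ) := by
    push_cast
    simpa only [Complex.mul_conj'] using key
  exact_mod_cast h

/-- The clock-and-shift unitaries form an orthogonal basis of `L(H)`, here in the form of Parseval's
identity. In terms of channels: their uniform mixture has Choi operator proportional to the
identity. -/
theorem exists_unitary_parseval (H : Type*) [NormedAddCommGroup H] [InnerProductSpace ℂ H]
    [FiniteDimensional ℂ H] [NeZero (Module.finrank ℂ H)] :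
    ∃ U : ZMod (Module.finrank ℂ H) × ZMod (Module.finrank ℂ H) → unitary (H →ₗ[ℂ] H),
      ∀ X, ∑ m, ‖hs X (U m : H →ₗ[ℂ] H)‖ ^ 2 = Module.finrank ℂ H * ‖hs X X‖ := by
  classical
  set n := Module.finrank ℂ H with hn
  let e : OrthonormalBasis (ZMod n) ℂ H := (stdOrthonormalBasis ℂ H).reindex
    (Fintype.equivOfCardEq (by rw [Fintype.card_fin, ZMod.card]))
  have hv : ∀ m : ZMod n × ZMod n,
      Orthonormal ℂ fun j => (ZMod.stdAddChar (m.1 * j) : ℂ) • e (j + m.2) := fun m => by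
    refine orthonormal_iff_ite.2 fun i j => ?_
    rw [inner_smul_left, inner_smul_right, e.inner_eq_ite]
    by_cases h : i = j
    · subst h
      rw [if_pos rfl, if_pos rfl, mul_one, Complex.conj_mul', ZMod.stdAddChar_apply,
        Circle.norm_coe]
      simp
    · simp [h]
  choose U hU using fun m => exists_unitary_apply e (hv m)
  refine ⟨U, fun X => ?_⟩
  have h1 : ∀ m, hs X (U m : H →ₗ[ℂ] H) =
      ∑ j, ZMod.stdAddChar (m.1 * j) * ⟪X (e j), e (j + m.2)⟫_ℂ := fun m => by
    simp [hs_eq_sum e, hU]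
  have h2 : (‖hs X X‖ : ℝ) = ∑ j, ‖X (e j)‖ ^ 2 := by
    have : hs X X = ((∑ j, ‖X (e j)‖ ^ 2 : ℝ) : ℂ) := by
      rw [hs_eq_sum e]
      push_cast
      exact Finset.sum_congr rfl fun j _ => inner_self_eq_norm_sq_to_K _
    rw [this, Complex.norm_real, Real.norm_eq_abs,
      abs_of_nonneg (Finset.sum_nonneg fun j _ => sq_nonneg _)]
  simp only [h1, Fintype.sum_prod_type_right, h2]
  rw [Finset.sum_congr rfl fun c _ => sum_norm_sq_stdAddChar fun j => ⟪X (e j), e (j + c)⟫_ℂ,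
    ← Finset.mul_sum, Finset.sum_comm]
  refine congrArg _ ?_
  refine Finset.sum_congr rfl fun j _ => ?_
  rw [← e.sum_sq_norm_inner_left]
  exact Fintype.sum_equiv (Equiv.addLeft j) _ _ fun b => rfl

/-! ### Operators with the unitary overlaps of a rank-one operator -/

omit [FiniteDimensional ℂ H] in
theorem norm_eq_one_iff_inner {x : H} : ‖x‖ = 1 ↔ ⟪x, x⟫_ℂ = 1 := by
  refine ⟨inner_self_eq_one_of_norm_eq_one, fun h => ?_⟩
  have h1 := inner_self_eq_norm_sq (𝕜 := ℂ) x
  rw [h, RCLike.one_re] at h1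
  exact (pow_eq_one_iff_of_nonneg (norm_nonneg x) two_ne_zero).1 h1.symm

omit [FiniteDimensional ℂ H] in
theorem ketBra_mul_ketBra (x y z w : H) :
    ketBra x y * ketBra z w = ⟪y, z⟫_ℂ • ketBra x w := by
  ext v
  simp [smul_smul, mul_comm]

theorem star_ketBra (x y : H) : star (ketBra x y) = ketBra y x := by
  refine LinearMap.ext fun z => ext_inner_left ℂ fun v => ?_
  simp [LinearMap.star_eq_adjoint, LinearMap.adjoint_inner_right, inner_smul_left,
    inner_smul_right, mul_comm]

omit [FiniteDimensional ℂ H] in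
theorem mul_ketBra (V : H →ₗ[ℂ] H) (x y : H) : V * ketBra x y = ketBra (V x) y := by
  ext z
  simp

/-- Multiplication by a phase `z` along a unit vector `w` is unitary. -/
theorem one_add_smul_ketBra_mem_unitary {w : H} (hw : ‖w‖ = 1) {z : ℂ} (hz : ‖z‖ = 1) :
    1 + (z - 1) • ketBra w w ∈ unitary (H →ₗ[ℂ] H) := by
  have h1 : starRingEnd ℂ z * z = 1 := by rw [Complex.conj_mul', hz]; simp
  have hww : ⟪w, w⟫_ℂ = 1 := norm_eq_one_iff_inner.1 hw
  have key : star (1 + (z - 1) • ketBra w w) * (1 + (z - 1) • ketBra w w) = 1 := by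
    simp only [star_add, star_one, star_smul, star_ketBra, add_mul, mul_add, one_mul, mul_one,
      smul_mul_smul_comm, ketBra_mul_ketBra, hww, one_smul, add_assoc, ← add_smul]
    rw [add_eq_left]
    convert zero_smul ℂ (ketBra w w) using 2
    simp only [star_sub, star_one, RCLike.star_def]
    linear_combination h1
  exact Unitary.mem_iff.2 ⟨key, mul_eq_one_comm.1 key⟩

/-- A circle `z ↦ t + (z - 1) m` that meets the unit circle at `z = 1, -1, i` is centred at `0` or
constant. -/
theorem eq_zero_or_eq_of_norm_eq_one {t m : ℂ} (h1 : ‖t‖ = 1) (h2 : ‖t + (-1 - 1) * m‖ = 1)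
    (h3 : ‖t + (Complex.I - 1) * m‖ = 1) : m = 0 ∨ m = t := by
  have e (z : ℂ) (h : ‖z‖ = 1) : z.re * z.re + z.im * z.im = 1 := by
    rw [← Complex.normSq_apply, Complex.normSq_eq_norm_sq, h, one_pow]
  have e1 := e _ h1
  have e2 := e _ h2
  have e3 := e _ h3
  simp at e2 e3
  set a := t.re
  set b := t.im
  set c := m.re
  set d := m.im
  have p1 : c * c + d * d = a * c + b * d := by linarith
  have p2 : a * d - b * c = 0 := by linarith
  have q1 : c = a * (a * c + b * d) := by linear_combination -c * e1 - b * p2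
  have q2 : d = b * (a * c + b * d) := by linear_combination -d * e1 + a * p2
  have p3 : (a * c + b * d) * (a * c + b * d - 1) = 0 := by
    linear_combination p1 + (c * c + d * d) * e1 - (a * d - b * c) * p2
  rcases mul_eq_zero.1 p3 with h | h
  · left
    rw [h, mul_zero] at q1 q2
    exact Complex.ext q1 q2
  · right
    rw [sub_eq_zero.1 h, mul_one] at q1 q2
    exact Complex.ext q1 q2

/-- Equality in the Cauchy–Schwarz inequality. -/
theorem eq_smul_ketBra_of_norm_inner {N : H →ₗ[ℂ] H} (hN : hs N N = 1) {w : H} (hw : ‖w‖ = 1)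
    (h : ‖hs N (ketBra w w)‖ = 1) : ∃ c : ℂ, ‖c‖ = 1 ∧ N = c • ketBra w w := by
  have hww : ⟪w, w⟫_ℂ = 1 := norm_eq_one_iff_inner.1 hw
  refine ⟨hs (ketBra w w) N, by rw [norm_hs_comm, h], ?_⟩
  have h1 : hs (ketBra w w) (ketBra w w) = 1 := by
    rw [hs_ketBra_left, ketBra_apply, hww, one_smul, hww]
  have h2 : hs (ketBra w w) N * hs N (ketBra w w) = 1 := by
    rw [← hs_conj_symm (ketBra w w) N, Complex.conj_mul', h]
    simp
  rw [← sub_eq_zero, ← hs_self_eq_zero]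
  simp only [hs_sub_left, hs_sub_right, hs_smul_left, hs_smul_right, h1, hN, hs_conj_symm]
  linear_combination -h2

theorem exists_orthonormalBasis_mem {w : H} (hw : ‖w‖ = 1) :
    ∃ (b : OrthonormalBasis (Fin (Module.finrank ℂ H)) ℂ H) (i : Fin (Module.finrank ℂ H)),
      b i = w := by
  have hw0 : w ≠ 0 := fun h => by simp [h] at hw
  have hpos : 0 < Module.finrank ℂ H := Module.finrank_pos_iff_exists_ne_zero.2 ⟨w, hw0⟩
  have ho : Orthonormal ℂ (({(⟨0, hpos⟩ : Fin (Module.finrank ℂ H))} : Set _).domRestrict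
      fun _ => w) := by
    refine ⟨fun i => hw, fun i j hij => ?_⟩
    exact absurd (Subsingleton.elim i j) hij
  obtain ⟨b, hb⟩ := ho.exists_orthonormalBasis_extension_of_card_eq (by simp)
  exact ⟨b, _, hb _ rfl⟩

theorem exists_unitary_apply_eq {s t : H} (hs : ‖s‖ = 1) (ht : ‖t‖ = 1) :
    ∃ V : unitary (H →ₗ[ℂ] H), (V : H →ₗ[ℂ] H) s = t := by
  obtain ⟨b, i, rfl⟩ := exists_orthonormalBasis_mem hs
  obtain ⟨b', i', rfl⟩ := exists_orthonormalBasis_mem ht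
  obtain ⟨V, hV⟩ := exists_unitary_apply b (b'.reindex (Equiv.swap i i')).orthonormal
  exact ⟨V, by simp [hV]⟩

/-- An operator of Hilbert–Schmidt norm `1` with the same overlaps with all unitaries as `|s⟩⟨s|`
is, up to a phase, a projection `|w⟩⟨w|`, where `w = s` or `w` spans the orthogonal complement
of `s`; the latter can occur only in dimension two. -/
theorem exists_eq_smul_ketBra_self {s : H} (hs1 : ‖s‖ = 1) {N : H →ₗ[ℂ] H} (hN : hs N N = 1)
    (h : ∀ W : unitary (H →ₗ[ℂ] H), ‖hs N W‖ = ‖⟪s, (W : H →ₗ[ℂ] H) s⟫_ℂ‖) :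
    ∃ w : H, ‖w‖ = 1 ∧ (∃ c : ℂ, ‖c‖ = 1 ∧ N = c • ketBra w w) ∧
      (w = s ∨ ⟪s, w⟫_ℂ = 0 ∧ ∀ z, ‖z‖ = 1 → ⟪s, z⟫_ℂ = 0 → ⟪w, z⟫_ℂ ≠ 0) := by
  have hss : ⟪s, s⟫_ℂ = 1 := norm_eq_one_iff_inner.1 hs1
  have ht : ‖hs N 1‖ = 1 := by simpa [hs1] using h 1
  -- phases along `w ⊥ s` fix `s`, so they leave the overlap at `1`
  have hphase : ∀ w, ‖w‖ = 1 → ⟪s, w⟫_ℂ = 0 →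
      hs N (ketBra w w) = 0 ∨ hs N (ketBra w w) = hs N 1 := fun w hw hsw => by
    have hz : ∀ z : ℂ, ‖z‖ = 1 → ‖hs N 1 + (z - 1) * hs N (ketBra w w)‖ = 1 := fun z hz => by
      have := h ⟨_, one_add_smul_ketBra_mem_unitary hw hz⟩
      rw [hs_add_right, hs_smul_right] at this
      rw [this]
      simp [hsw, hs1]
    exact eq_zero_or_eq_of_norm_eq_one ht (hz (-1) (by simp)) (hz _ (by simp))
  by_cases hex : ∃ w, ‖w‖ = 1 ∧ ⟪s, w⟫_ℂ = 0 ∧ hs N (ketBra w w) ≠ 0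
  · obtain ⟨w, hw, hsw, hne⟩ := hex
    have hww : ⟪w, w⟫_ℂ = 1 := norm_eq_one_iff_inner.1 hw
    have hm : ‖hs N (ketBra w w)‖ = 1 := by rw [(hphase w hw hsw).resolve_left hne, ht]
    obtain ⟨c, hc, rfl⟩ := eq_smul_ketBra_of_norm_inner hN hw hm
    refine ⟨w, hw, ⟨c, hc, rfl⟩, Or.inr ⟨hsw, fun z hz hsz hwz => ?_⟩⟩
    -- the unit vector `(w + z) / √2` would have the overlap `1 / 2`
    have hzw : ⟪z, w⟫_ℂ = 0 := inner_eq_zero_symm.1 hwz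
    have hzz : ⟪z, z⟫_ℂ = 1 := norm_eq_one_iff_inner.1 hz
    have hr : (((√2)⁻¹ : ℝ) : ℂ) * (((√2)⁻¹ : ℝ) : ℂ) = 1 / 2 := by
      rw [← Complex.ofReal_mul, ← mul_inv, Real.mul_self_sqrt (by norm_num)]
      norm_num
    set r : ℂ := (((√2)⁻¹ : ℝ) : ℂ) with hrdef
    have hrc : starRingEnd ℂ r = r := Complex.conj_ofReal _
    have hv : ⟪r • (w + z), r • (w + z)⟫_ℂ = 1 := by
      simp only [inner_smul_left, inner_smul_right, inner_add_left, inner_add_right, hrc, hww, hzz,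
        hwz, hzw]
      linear_combination 2 * hr
    have hv1 : ‖r • (w + z)‖ = 1 := norm_eq_one_iff_inner.2 hv
    have hval : ‖hs (c • ketBra w w) (ketBra (r • (w + z)) (r • (w + z)))‖ = 1 / 2 := by
      rw [hs_smul_left, hs_ketBra_left]
      simp only [ketBra_apply, inner_smul_left, inner_smul_right, inner_add_left, inner_add_right,
        hrc, hww, hwz, hzw]
      rw [norm_mul, RCLike.norm_conj, hc]
      have : r * (1 + 0) * (r * (1 + 0)) = 1 / 2 := by linear_combination hr
      rw [this]
      norm_num
    have hsv : ⟪s, r • (w + z)⟫_ℂ = 0 := by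
      rw [inner_smul_right, inner_add_right, hsw, hsz, add_zero, mul_zero]
    rcases hphase _ hv1 hsv with h0 | h0
    · rw [h0] at hval; norm_num at hval
    · rw [h0, ht] at hval; norm_num at hval
  · push Not at hex
    refine ⟨s, hs1, eq_smul_ketBra_of_norm_inner hN hs1 ?_, Or.inl rfl⟩
    obtain ⟨b, i, rfl⟩ := exists_orthonormalBasis_mem hs1
    have h1 : hs N 1 = hs N (ketBra (b i) (b i)) := by
      rw [hs_eq_sum b, hs_ketBra_right, Finset.sum_eq_single i]
      · rfl
      · intro j _ hj
        have := hex (b j) (b.orthonormal.1 j) (b.orthonormal.2 hj.symm)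
        rwa [hs_ketBra_right] at this
      · simp
    rw [← h1, ht]

/-- An operator of Hilbert–Schmidt norm `1` with the same overlaps with all unitaries as `|t⟩⟨s|` is
`|t⟩⟨s|` up to a phase, or, in dimension two only, some `|x⟩⟨w|` with `w` orthogonal to `s`. -/
theorem exists_conjMap_eq_conjMap_ketBra {s t : H} (hs1 : ‖s‖ = 1) (ht1 : ‖t‖ = 1)
    {K : H →ₗ[ℂ] H} (hK : hs K K = 1)
    (h : ∀ V : unitary (H →ₗ[ℂ] H), ‖hs K V‖ = ‖⟪t, (V : H →ₗ[ℂ] H) s⟫_ℂ‖) :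
    ∃ x w : H, ‖x‖ = 1 ∧ ‖w‖ = 1 ∧ conjMap K = conjMap (ketBra x w) ∧
      (w = s ∧ x = t ∨ ⟪s, w⟫_ℂ = 0 ∧ ∀ z, ‖z‖ = 1 → ⟪s, z⟫_ℂ = 0 → ⟪w, z⟫_ℂ ≠ 0) := by
  obtain ⟨V, rfl⟩ := exists_unitary_apply_eq hs1 ht1
  have hVK : (V : H →ₗ[ℂ] H) * (star (V : H →ₗ[ℂ] H) * K) = K := by
    rw [← mul_assoc, Unitary.mul_star_self_of_mem V.2, one_mul]
  have hVi : ∀ x y, ⟪(V : H →ₗ[ℂ] H) x, (V : H →ₗ[ℂ] H) y⟫_ℂ = ⟪x, y⟫_ℂ := fun x y => by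
    rw [← LinearMap.adjoint_inner_right, ← LinearMap.star_eq_adjoint, ← Module.End.mul_apply,
      Unitary.star_mul_self_of_mem V.2, Module.End.one_apply]
  obtain ⟨w, hw, ⟨c, hc, hcw⟩, hor⟩ := exists_eq_smul_ketBra_self hs1
    (N := star (V : H →ₗ[ℂ] H) * K) (by rw [← hs_mul_right, hVK, hK]) (fun W => by
      rw [← hs_mul_right]
      exact (h (V * W)).trans (by rw [← hVi s]; rfl))
  refine ⟨(V : H →ₗ[ℂ] H) w, w, ?_, hw, ?_, hor.imp_left fun e => ⟨e, by rw [e]⟩⟩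
  · rw [norm_eq_one_iff_inner, hVi, ← norm_eq_one_iff_inner, hw]
  · rw [← hVK, hcw, mul_smul_comm, mul_ketBra, conjMap_smul, hc]
    simp

/-! ### Symmetries that permute the unitary channels -/

theorem norm_hs_sq_le (X Y : H →ₗ[ℂ] H) : ‖hs X Y‖ ^ 2 ≤ ‖hs X X‖ * ‖hs Y Y‖ := by
  have h : ‖hs X Y‖ * ‖hs Y X‖ ≤ (hs X X).re * (hs Y Y).re :=
    letI := (hsCore (H := H)).toCore
    InnerProductSpace.Core.inner_mul_inner_self_le (𝕜 := ℂ) X Y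
  rw [norm_hs_comm Y X, ← sq] at h
  exact h.trans (mul_le_mul (Complex.re_le_norm _) (Complex.re_le_norm _)
    (Complex.le_def.1 (hs_self_nonneg Y)).1 (norm_nonneg _))

omit [FiniteDimensional ℂ H] in
theorem sum_smul_mem_Op {ι : Type*} [Fintype ι] {p : ι → ℝ} (hp : ∀ i, 0 ≤ p i)
    (hp1 : ∑ i, p i ≤ 1) (Q : ι → Op H H) : ∑ i, (p i : ℂ) • (Q i).1 ∈ Op H H := by
  refine ⟨IsCompletelyPositive.sum fun i _ => (Q i).2.1.smul (hp i), fun ρ hρ => ?_⟩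
  have h0 : 0 ≤ (LinearMap.trace ℂ H ρ).re := (Complex.le_def.1 hρ.trace_nonneg).1
  simp only [LinearMap.sum_apply, map_sum, LinearMap.smul_apply, map_smul, smul_eq_mul,
    Complex.re_sum, Complex.re_ofReal_mul]
  calc _ ≤ ∑ i, p i * (LinearMap.trace ℂ H ρ).re :=
        Finset.sum_le_sum fun i _ => mul_le_mul_of_nonneg_left ((Q i).2.2 ρ hρ) (hp i)
    _ = (∑ i, p i) * (LinearMap.trace ℂ H ρ).re := (Finset.sum_mul _ _ _).symm
    _ ≤ _ := mul_le_of_le_one_left h0 hp1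

theorem OpSymmetry.map_sum_smul (S : OpSymmetry H H H H) {ι : Type*} [Fintype ι] {p : ι → ℝ}
    (hp : ∀ i, 0 ≤ p i) (hp1 : ∑ i, p i ≤ 1) (Q : ι → Op H H) {T : Op H H}
    (hT : T.1 = ∑ i, (p i : ℂ) • (Q i).1) :
    (S.toFun T).1 = ∑ i, (p i : ℂ) • (S.toFun (Q i)).1 := by
  have hpi : ∀ i, p i ∈ Set.Icc (0 : ℝ) 1 := fun i =>
    ⟨hp i, (Finset.single_le_sum (fun j _ => hp j) (Finset.mem_univ i)).trans hp1⟩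
  rw [S.map_sum Finset.univ (fun i => ⟨(p i : ℂ) • (Q i).1, smul_mem_Op (Q i).2 (hpi i)⟩) hT]
  exact Finset.sum_congr rfl fun i _ => S.map_smul (hpi i) rfl

/-- Order thresholds below a mixture of the unitary channels of an orthogonal operator basis and of
one more channel `ρ ↦ V ρ V†`. -/
theorem isCompletelyPositive_sub_smul_conjMap_iff {ι : Type*} [Fintype ι] {n : ℝ} (hn : 0 < n)
    {U : ι → (H →ₗ[ℂ] H)} (hU : ∀ X, ∑ m, ‖hs X (U m)‖ ^ 2 = n * ‖hs X X‖)
    {V : H →ₗ[ℂ] H} (hV : ‖hs V V‖ = n) (K : H →ₗ[ℂ] H) {c j r : ℝ} (hc : 0 < c) (hj : 0 ≤ j)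
    (hr : 0 ≤ r) :
    IsCompletelyPositive (((c * j : ℝ) : ℂ) • conjMap V + ∑ m, (c : ℂ) • conjMap (U m) -
        (r : ℂ) • conjMap K) ↔
      r * (‖hs K K‖ - j / n * ‖hs K V‖ ^ 2 / (1 + j)) ≤ c * n := by
  have hcn : 0 < c * n := mul_pos hc hn
  have hjn : 0 ≤ j / n := div_nonneg hj hn.le
  set W : H →ₗ[ℂ] H := ((√(j / n) : ℝ) : ℂ) • V with hW
  have hsq : ‖((√(j / n) : ℝ) : ℂ)‖ ^ 2 = j / n := by
    rw [Complex.norm_real, Real.norm_eq_abs, sq_abs, Real.sq_sqrt hjn]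
  have hWl : ∀ X, ‖hs W X‖ ^ 2 = j / n * ‖hs V X‖ ^ 2 := fun X => by
    rw [hW, hs_smul_left, norm_mul, RCLike.norm_conj, mul_pow, hsq]
  have hWr : ∀ X, ‖hs X W‖ ^ 2 = j / n * ‖hs X V‖ ^ 2 := fun X => by
    rw [norm_hs_comm X W, norm_hs_comm X V, hWl]
  have hWW : ‖hs W W‖ = j := by
    rw [hW, hs_smul_left, hs_smul_right, norm_mul, norm_mul, RCLike.norm_conj, hV, ← mul_assoc,
      ← sq, hsq, div_mul_cancel₀ _ hn.ne']
  have key := forall_mul_norm_hs_sq_le_iff K W (r := r / (c * n)) (by positivity)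
  rw [hWW, hWr, div_mul_eq_mul_div, div_le_one hcn] at key
  rw [← key, isCompletelyPositive_iff]
  refine forall_congr' fun X => ?_
  have e : choiForm (((c * j : ℝ) : ℂ) • conjMap V + ∑ m, (c : ℂ) • conjMap (U m) -
      (r : ℂ) • conjMap K) X =
      ((c * n * (‖hs X X‖ + ‖hs W X‖ ^ 2) - r * ‖hs K X‖ ^ 2 : ℝ) : ℂ) := by
    simp only [choiForm_sub, choiForm_add, choiForm_sum, choiForm_smul, choiForm_conjMap,
      ← Finset.mul_sum, ← Complex.ofReal_mul, ← Complex.ofReal_sum, ← Complex.ofReal_add,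
      ← Complex.ofReal_sub, norm_hs_comm (U _) X, hU, hWl]
    congr 1
    field_simp
    ring
  rw [e, Complex.zero_le_real, sub_nonneg, div_mul_eq_mul_div, div_le_iff₀ hcn, mul_comm (c * n)]

/-- A real number is determined by the scalars `r ∈ [0, 1]` with `r * a ≤ q`, as long as the
threshold `q / a` stays away from `1`. -/
theorem eq_of_forall_mul_le_iff {a a' q : ℝ} (hq : 0 < q) (ha : 2 * q ≤ a)
    (h : ∀ r ∈ Set.Icc (0 : ℝ) 1, r * a ≤ q ↔ r * a' ≤ q) : a = a' := by
  have ha0 : 0 < a := by linarith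
  have hqa' : q < a' := by
    by_contra hc
    have := (h 1 (by norm_num)).2 (by linarith)
    linarith
  refine le_antisymm ?_ ?_
  · have h1 := (h (q / a') ⟨div_nonneg hq.le (hq.trans hqa').le,
      (div_le_one (hq.trans hqa')).2 hqa'.le⟩).2
      (by rw [div_mul_cancel₀ _ (by linarith)])
    rw [div_mul_eq_mul_div, div_le_iff₀ (by linarith)] at h1
    exact le_of_mul_le_mul_left h1 hq
  · have h1 := (h (q / a) ⟨by positivity, (div_le_one ha0).2 (by linarith)⟩).1
      (by rw [div_mul_cancel₀ _ ha0.ne'])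
    rw [div_mul_eq_mul_div, div_le_iff₀ ha0] at h1
    exact le_of_mul_le_mul_left h1 hq

theorem hs_unitary_self (U : unitary (H →ₗ[ℂ] H)) :
    hs (U : H →ₗ[ℂ] H) (U : H →ₗ[ℂ] H) = Module.finrank ℂ H := by
  rw [hs, Unitary.star_mul_self_of_mem U.2, LinearMap.trace_one]

/-- If the permutation `τ` of the unitaries induced by a symmetry is implemented by a
norm-preserving map `σ` of `L(H)`, the symmetry preserves the Hilbert–Schmidt norm of the atomic
operations and their overlaps with the unitary channels. -/
theorem OpSymmetry.norm_hs_eq (hdim : 2 ≤ Module.finrank ℂ H) {S : OpSymmetry H H H H}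
    {τ : unitary (H →ₗ[ℂ] H) → unitary (H →ₗ[ℂ] H)} {σ : (H →ₗ[ℂ] H) → (H →ₗ[ℂ] H)}
    (hS : ∀ U, S.toFun (unitaryChannel U) = unitaryChannel (τ U))
    (hσ : ∀ X, ‖hs (σ X) (σ X)‖ = ‖hs X X‖)
    (hστ : ∀ X U, ‖hs X (τ U : H →ₗ[ℂ] H)‖ = ‖hs (σ X) (U : H →ₗ[ℂ] H)‖)
    {Q : Op H H} {K K' : H →ₗ[ℂ] H} (hQ : Q.1 = conjMap K) (hSQ : (S.toFun Q).1 = conjMap K')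
    (hK : ‖hs K K‖ = 1) :
    ‖hs K' K'‖ = 1 ∧
      ∀ U : unitary (H →ₗ[ℂ] H), ‖hs K' (τ U : H →ₗ[ℂ] H)‖ = ‖hs K (U : H →ₗ[ℂ] H)‖ := by
  have : NeZero (Module.finrank ℂ H) := ⟨by omega⟩
  obtain ⟨U, hU⟩ := exists_unitary_parseval H
  set n : ℝ := (Module.finrank ℂ H : ℝ) with hn
  have hn2 : 2 ≤ n := by rw [hn]; exact_mod_cast hdim
  have hn0 : 0 < n := by linarith
  have hU' : ∀ X, ∑ m, ‖hs X (τ (U m) : H →ₗ[ℂ] H)‖ ^ 2 = n * ‖hs X X‖ := fun X => by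
    simp only [hστ, hU, hσ]
  have hVV : ∀ V : unitary (H →ₗ[ℂ] H), ‖hs (V : H →ₗ[ℂ] H) (V : H →ₗ[ℂ] H)‖ = n := fun V => by
    rw [hs_unitary_self, Complex.norm_natCast]
  -- the factor `2` in `c` keeps the thresholds of `K` below `1`
  set c : ℝ := 1 / (2 * (n ^ 2 + 1)) with hc
  have hc0 : 0 < c := by positivity
  have hcn : 4 * (c * n) ≤ 1 := by
    rw [hc, div_mul_eq_mul_div, mul_div_assoc', div_le_one (by positivity)]
    nlinarith
  have key : ∀ (V : unitary (H →ₗ[ℂ] H)) (j : ℝ), 0 ≤ j → j ≤ 1 → ∀ r ∈ Set.Icc (0 : ℝ) 1,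
      (r * (‖hs K K‖ - j / n * ‖hs K (V : H →ₗ[ℂ] H)‖ ^ 2 / (1 + j)) ≤ c * n ↔
        r * (‖hs K' K'‖ - j / n * ‖hs K' (τ V : H →ₗ[ℂ] H)‖ ^ 2 / (1 + j)) ≤ c * n) := by
    intro V j hj0 hj1 r hr
    let p : Option (ZMod (Module.finrank ℂ H) × ZMod (Module.finrank ℂ H)) → ℝ :=
      fun o => o.elim (c * j) fun _ => c
    let F : Option (ZMod (Module.finrank ℂ H) × ZMod (Module.finrank ℂ H)) → Op H H :=
      fun o => o.elim (unitaryChannel V) fun m => unitaryChannel (U m)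
    have hp : ∀ o, 0 ≤ p o := by
      rintro (_ | m)
      · exact mul_nonneg hc0.le hj0
      · exact hc0.le
    have hp1 : ∑ o, p o ≤ 1 := by
      have : ∑ o, p o = c * j + n ^ 2 * c := by
        simp only [Fintype.sum_option, p, Option.elim, Finset.sum_const, Finset.card_univ,
          Fintype.card_prod, ZMod.card, nsmul_eq_mul, Nat.cast_mul, sq, hn]
      rw [this, hc, div_mul_eq_mul_div, mul_div_assoc', ← add_div, div_le_one (by positivity)]
      nlinarith
    let A : Op H H := ⟨∑ o, (p o : ℂ) • (F o).1, sum_smul_mem_Op hp hp1 F⟩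
    let B : Op H H := ⟨(r : ℂ) • Q.1, smul_mem_Op Q.2 hr⟩
    have hA : A.1 = ((c * j : ℝ) : ℂ) • conjMap (V : H →ₗ[ℂ] H) +
        ∑ m, (c : ℂ) • conjMap (U m : H →ₗ[ℂ] H) := by
      simp only [A, Fintype.sum_option]
      rfl
    have hSA : (S.toFun A).1 = ((c * j : ℝ) : ℂ) • conjMap (τ V : H →ₗ[ℂ] H) +
        ∑ m, (c : ℂ) • conjMap (τ (U m) : H →ₗ[ℂ] H) := by
      rw [S.map_sum_smul hp hp1 F rfl, Fintype.sum_option]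
      simp only [F, p, Option.elim, hS]
      rfl
    have hSB : (S.toFun B).1 = (r : ℂ) • conjMap K' := by
      rw [S.map_smul (Q := Q) hr rfl, hSQ]
    have hB : B.1 = (r : ℂ) • conjMap K := by rw [← hQ]
    have h := S.le_iff_le (Q := B) (R := A)
    rw [hSA, hSB, hA, hB, isCompletelyPositive_sub_smul_conjMap_iff hn0 hU (hVV V) K hc0 hj0 hr.1,
      isCompletelyPositive_sub_smul_conjMap_iff hn0 hU' (hVV _) K' hc0 hj0 hr.1] at h
    exact h.symm
  have hcn0 : 0 < c * n := mul_pos hc0 hn0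
  have h1 : ‖hs K' K'‖ = 1 := by
    have := eq_of_forall_mul_le_iff hcn0 (by rw [hK]; simp; linarith)
      (key 1 0 le_rfl zero_le_one)
    simpa [hK] using this.symm
  refine ⟨h1, fun V => ?_⟩
  have hCS : ‖hs K (V : H →ₗ[ℂ] H)‖ ^ 2 ≤ n := by
    simpa [hK, hVV] using norm_hs_sq_le K (V : H →ₗ[ℂ] H)
  have h2 := eq_of_forall_mul_le_iff hcn0 (by
    rw [hK]
    have : 1 / n * ‖hs K (V : H →ₗ[ℂ] H)‖ ^ 2 ≤ 1 := by
      rwa [div_mul_eq_mul_div, one_mul, div_le_one hn0]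
    linarith) (key V 1 zero_le_one le_rfl)
  rw [hK, h1] at h2
  have h3 : ‖hs K' (τ V : H →ₗ[ℂ] H)‖ ^ 2 = ‖hs K (V : H →ₗ[ℂ] H)‖ ^ 2 := by
    field_simp at h2
    linarith
  exact (pow_left_inj₀ (norm_nonneg _) (norm_nonneg _) two_ne_zero).1 h3

/-! ### Rank-one Kraus operators with a common output vector -/

theorem conjMap_ketBra_apply (s t : H) (ρ : H →ₗ[ℂ] H) :
    conjMap (ketBra s t) ρ = ⟪t, ρ t⟫_ℂ • ketBra s s := by
  change ketBra s t * ρ * star (ketBra s t) = _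
  rw [star_ketBra, mul_assoc, mul_ketBra, ketBra_mul_ketBra]

theorem trace_ketBra (x y : H) : LinearMap.trace ℂ H (ketBra x y) = ⟪y, x⟫_ℂ :=
  InnerProductSpace.trace_rankOne x y

omit [FiniteDimensional ℂ H] in
theorem ketBra_self_isPositive (x : H) : (ketBra x x).IsPositive := by
  refine (LinearMap.isPositive_iff_complex _).2 fun y => ?_
  have : ⟪ketBra x x y, y⟫_ℂ = ((‖⟪x, y⟫_ℂ‖ ^ 2 : ℝ) : ℂ) := by
    rw [ketBra_apply, inner_smul_left, Complex.conj_mul', Complex.ofReal_pow]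
  rw [this]
  exact ⟨rfl, sq_nonneg _⟩

theorem conjMap_ketBra_add_mem_Op {s t t' : H} (hs1 : ‖s‖ = 1) (ht : ‖t‖ = 1) (ht' : ‖t'‖ = 1)
    (htt' : ⟪t, t'⟫_ℂ = 0) : conjMap (ketBra s t) + conjMap (ketBra s t') ∈ Op H H := by
  classical
  refine ⟨(isCompletelyPositive_conjMap _).add (isCompletelyPositive_conjMap _), fun ρ hρ => ?_⟩
  have hne : t ≠ t' := by
    rintro rfl
    rw [norm_eq_one_iff_inner.1 ht] at htt'
    exact one_ne_zero htt'
  have ho : Orthonormal ℂ ((↑) : ({t, t'} : Set H) → H) := by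
    refine ⟨?_, ?_⟩
    · rintro ⟨x, rfl | rfl⟩
      · exact ht
      · exact ht'
    · rintro ⟨x, rfl | rfl⟩ ⟨y, rfl | rfl⟩ hxy
      · exact absurd rfl hxy
      · exact htt'
      · exact inner_eq_zero_symm.1 htt'
      · exact absurd rfl hxy
  obtain ⟨u, b, hu, hb⟩ := ho.exists_orthonormalBasis_extension
  have htu : t ∈ u := hu (by simp)
  have htu' : t' ∈ u := hu (by simp)
  have hsub : ({⟨t, htu⟩, ⟨t', htu'⟩} : Finset u) ⊆ Finset.univ := Finset.subset_univ _
  have hle := Finset.sum_le_sum_of_subset_of_nonneg (f := fun i : u => (⟪b i, ρ (b i)⟫_ℂ).re) hsub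
    fun i _ _ => (Complex.le_def.1 (hρ.inner_nonneg_right (b i))).1
  rw [Finset.sum_pair (by simpa using hne), ← Complex.re_sum,
    ← LinearMap.trace_eq_sum_inner ρ b] at hle
  simpa [conjMap_ketBra_apply, trace_ketBra, hb, hs1] using hle

/-- Suppose a symmetry `S` turns the overlaps of the unitary channels with `|s⟩⟨t|` and `|s⟩⟨t'|`
into overlaps with `|t⟩⟨s|` and `|t'⟩⟨s|`. The images of these two atoms are again of rank one, and
since their sum is trace non-increasing their input vectors are orthogonal. This leaves one of them
with input `s`, and the other one annihilates `|s⟩⟨s|`. -/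
theorem OpSymmetry.apply_ketBra_self (hdim : 2 ≤ Module.finrank ℂ H) {S : OpSymmetry H H H H}
    {τ : unitary (H →ₗ[ℂ] H) → unitary (H →ₗ[ℂ] H)} {σ : (H →ₗ[ℂ] H) → (H →ₗ[ℂ] H)}
    (hS : ∀ U, S.toFun (unitaryChannel U) = unitaryChannel (τ U)) (hτ : Function.Surjective τ)
    (hσ : ∀ X, ‖hs (σ X) (σ X)‖ = ‖hs X X‖)
    (hστ : ∀ X U, ‖hs X (τ U : H →ₗ[ℂ] H)‖ = ‖hs (σ X) (U : H →ₗ[ℂ] H)‖)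
    {s t t' : H} (hs1 : ‖s‖ = 1) (ht : ‖t‖ = 1) (ht' : ‖t'‖ = 1) (htt' : ⟪t, t'⟫_ℂ = 0)
    (hst : σ (ketBra t s) = ketBra s t) (hst' : σ (ketBra t' s) = ketBra s t')
    {Q : Op H H} (hQ : Q.1 = conjMap (ketBra s t) + conjMap (ketBra s t')) :
    (S.toFun Q).1 (ketBra s s) = ketBra t t ∨ (S.toFun Q).1 (ketBra s s) = ketBra t' t' := by
  have atom : ∀ {v : H} {R : Op H H}, ‖v‖ = 1 → σ (ketBra v s) = ketBra s v →
      R.1 = conjMap (ketBra s v) → ∃ x w : H, ‖x‖ = 1 ∧ ‖w‖ = 1 ∧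
        (S.toFun R).1 = conjMap (ketBra x w) ∧ (w = s ∧ x = v ∨
          ⟪s, w⟫_ℂ = 0 ∧ ∀ z, ‖z‖ = 1 → ⟪s, z⟫_ℂ = 0 → ⟪w, z⟫_ℂ ≠ 0) := by
    intro v R hv hsv hR
    have hK : hs (ketBra s v) (ketBra s v) = 1 := by
      rw [hs_ketBra_left, ketBra_apply, norm_eq_one_iff_inner.1 hv, one_smul,
        norm_eq_one_iff_inner.1 hs1]
    have hK0 : ketBra s v ≠ 0 := fun h => by
      rw [hs_self_eq_zero.2 h] at hK
      exact zero_ne_one hK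
    obtain ⟨K', hK'⟩ := S.exists_conjMap hK0 hR
    obtain ⟨h1, h2⟩ := S.norm_hs_eq hdim hS hσ hστ hR hK' (by rw [hK, norm_one])
    obtain ⟨x, w, hx, hw, hKw, hor⟩ := exists_conjMap_eq_conjMap_ketBra hs1 hv (K := K')
      (by rw [hs_self_eq_norm, h1, Complex.ofReal_one]) (fun V => by
        obtain ⟨U, rfl⟩ := hτ V
        rw [h2, ← hs_ketBra_left, hστ, hsv])
    exact ⟨x, w, hx, hw, hK'.trans hKw, hor⟩
  let R : Op H H := ⟨conjMap (ketBra s t), mem_Op_of_le (isCompletelyPositive_conjMap _)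
    (by rw [hQ, add_sub_cancel_left]; exact isCompletelyPositive_conjMap _) Q.2⟩
  let R' : Op H H := ⟨conjMap (ketBra s t'), mem_Op_of_le (isCompletelyPositive_conjMap _)
    (by rw [hQ, add_sub_cancel_right]; exact isCompletelyPositive_conjMap _) Q.2⟩
  obtain ⟨x, w, hx, hw, hR, hor⟩ := atom (R := R) ht hst rfl
  obtain ⟨x', w', hx', hw', hR', hor'⟩ := atom (R := R') ht' hst' rfl
  have hsum : (S.toFun Q).1 = conjMap (ketBra x w) + conjMap (ketBra x' w') := by
    rw [← hR, ← hR', S.map_add (Q := R) (R := R') hQ]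
  have hww' : ⟪w', w⟫_ℂ = 0 := by
    have h := (S.toFun Q).2.2 _ (ketBra_self_isPositive w)
    have e : ⟪w', w⟫_ℂ * ⟪w, w'⟫_ℂ = ((‖⟪w', w⟫_ℂ‖ ^ 2 : ℝ) : ℂ) := by
      rw [← inner_conj_symm w w', Complex.mul_conj', Complex.ofReal_pow]
    simp only [hsum, LinearMap.add_apply, conjMap_ketBra_apply, ketBra_apply, _root_.map_add,
      _root_.map_smul,
      trace_ketBra, norm_eq_one_iff_inner.1 hw, norm_eq_one_iff_inner.1 hx,
      norm_eq_one_iff_inner.1 hx', inner_smul_right, smul_eq_mul, mul_one] at h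
    rw [mul_comm, e] at h
    rw [Complex.add_re, Complex.one_re, Complex.ofReal_re] at h
    exact norm_eq_zero.1 (pow_eq_zero_iff two_ne_zero |>.1
      (le_antisymm (by linarith) (sq_nonneg _)))
  have hss := norm_eq_one_iff_inner.1 hs1
  rw [hsum]
  simp only [LinearMap.add_apply, conjMap_ketBra, ketBra_apply]
  rcases hor with ⟨rfl, rfl⟩ | ⟨hsw, hmax⟩ <;> rcases hor' with ⟨rfl, rfl⟩ | ⟨hsw', hmax'⟩
  · rw [hss] at hww'
    exact absurd hww' one_ne_zero
  · left
    rw [inner_eq_zero_symm.1 hsw', hss]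
    ext; simp
  · right
    rw [inner_eq_zero_symm.1 hsw, hss]
    ext; simp
  · exact absurd (inner_eq_zero_symm.1 hww') (hmax w' hw' hsw')

/-- No symmetry acts on the unitary channels by a permutation `τ` that is implemented by a
norm-preserving map `σ` of `L(H)` which exchanges input and output of the operators `|v⟩⟨e|`, with
`v` a real combination of the orthonormal vectors `e` and `f`. The operation with Kraus
operators `|e⟩⟨e|` and `|e⟩⟨f|` also has the Kraus operators `|e⟩⟨v|` and `|e⟩⟨v'|` with
`v, v' = (e ± f) / √2`, and the two decompositions disagree on the image of `|e⟩⟨e|`. -/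
theorem OpSymmetry.not_reverses (hdim : 2 ≤ Module.finrank ℂ H) {S : OpSymmetry H H H H}
    {τ : unitary (H →ₗ[ℂ] H) → unitary (H →ₗ[ℂ] H)} {σ : (H →ₗ[ℂ] H) → (H →ₗ[ℂ] H)}
    (hS : ∀ U, S.toFun (unitaryChannel U) = unitaryChannel (τ U)) (hτ : Function.Surjective τ)
    (hσ : ∀ X, ‖hs (σ X) (σ X)‖ = ‖hs X X‖)
    (hστ : ∀ X U, ‖hs X (τ U : H →ₗ[ℂ] H)‖ = ‖hs (σ X) (U : H →ₗ[ℂ] H)‖)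
    {e f : H} (he : ‖e‖ = 1) (hf : ‖f‖ = 1) (hef : ⟪e, f⟫_ℂ = 0)
    (hσe : ∀ a b : ℝ, σ (ketBra ((a : ℂ) • e + (b : ℂ) • f) e) =
      ketBra e ((a : ℂ) • e + (b : ℂ) • f)) : False := by
  have hee := norm_eq_one_iff_inner.1 he
  have hff := norm_eq_one_iff_inner.1 hf
  have hfe : ⟪f, e⟫_ℂ = 0 := inner_eq_zero_symm.1 hef
  have hr : (((√2)⁻¹ : ℝ) : ℂ) * (((√2)⁻¹ : ℝ) : ℂ) = 1 / 2 := by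
    rw [← Complex.ofReal_mul, ← mul_inv, Real.mul_self_sqrt (by norm_num)]
    norm_num
  set r : ℝ := (√2)⁻¹ with hrdef
  let v (a b : ℝ) : H := (a : ℂ) • e + (b : ℂ) • f
  have hv : ∀ a b a' b' : ℝ, ⟪v a b, v a' b'⟫_ℂ = a * a' + b * b' := fun a b a' b' => by
    simp only [v, inner_add_left, inner_add_right, inner_smul_left, inner_smul_right, hee, hff, hef,
      hfe, Complex.conj_ofReal]
    ring
  have hv1 : ‖v r r‖ = 1 := norm_eq_one_iff_inner.2 (by rw [hv]; linear_combination 2 * hr)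
  have hv2 : ‖v r (-r)‖ = 1 := norm_eq_one_iff_inner.2 (by
    rw [hv]; push_cast; linear_combination 2 * hr)
  have hv12 : ⟪v r r, v r (-r)⟫_ℂ = 0 := by rw [hv]; push_cast; ring
  have hE : v 1 0 = e := by simp [v]
  have hF : v 0 1 = f := by simp [v]
  let Q : Op H H := ⟨_, conjMap_ketBra_add_mem_Op he he hf hef⟩
  have hQ : Q.1 = conjMap (ketBra e (v r r)) + conjMap (ketBra e (v r (-r))) := by
    refine LinearMap.ext fun ρ => ?_
    simp only [Q, LinearMap.add_apply, conjMap_ketBra_apply, ← add_smul]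
    congr 1
    simp only [v, _root_.map_add, _root_.map_smul, inner_add_left, inner_add_right, inner_smul_left,
      inner_smul_right, Complex.conj_ofReal, Complex.ofReal_neg, map_neg]
    linear_combination (-2 * ⟪e, ρ e⟫_ℂ - 2 * ⟪f, ρ f⟫_ℂ) * hr
  have h1 := S.apply_ketBra_self hdim hS hτ hσ hστ he he hf hef
    (by simpa [hE] using hσe 1 0) (by simpa [hF] using hσe 0 1) (Q := Q) rfl
  have h2 := S.apply_ketBra_self hdim hS hτ hσ hστ he hv1 hv2 hv12 (hσe _ _) (hσe _ _) hQ
  have hev : ∀ b : ℝ, ⟪v r b, e⟫_ℂ * ⟪e, v r b⟫_ℂ = 1 / 2 := fun b => by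
    rw [← hE, hv, hv]; push_cast; linear_combination hr
  have h3 : ⟪e, (S.toFun Q).1 (ketBra e e) e⟫_ℂ = 1 / 2 := by
    rcases h2 with h | h <;> rw [h, ketBra_apply, inner_smul_right, hev]
  rcases h1 with h | h <;> rw [h] at h3 <;> simp [hfe, he] at h3

/-! ### The adjoint and the transpose -/

theorem transposeOp_apply_inner {ι : Type*} [Fintype ι] [DecidableEq ι]
    (b : OrthonormalBasis ι ℂ H) (A : H →ₗ[ℂ] H) (i j : ι) :
    ⟪b i, transposeOp b A (b j)⟫_ℂ = ⟪b j, A (b i)⟫_ℂ := by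
  rw [← LinearMap.toMatrixOrthonormal_apply_apply, ← LinearMap.toMatrixOrthonormal_apply_apply,
    transposeOp, StarAlgEquiv.apply_symm_apply, Matrix.transpose_apply]

theorem eq_transposeOp_of_inner {ι : Type*} [Fintype ι] [DecidableEq ι]
    (b : OrthonormalBasis ι ℂ H) {A B : H →ₗ[ℂ] H}
    (h : ∀ i j, ⟪b j, A (b i)⟫_ℂ = ⟪b i, B (b j)⟫_ℂ) : transposeOp b A = B := by
  refine b.toBasis.ext fun j => InnerProductSpace.ext_inner_left_basis b.toBasis fun i => ?_
  simpa [transposeOp_apply_inner] using h i j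

theorem transposeOp_transposeOp {ι : Type*} [Fintype ι] [DecidableEq ι]
    (b : OrthonormalBasis ι ℂ H) (A : H →ₗ[ℂ] H) : transposeOp b (transposeOp b A) = A :=
  eq_transposeOp_of_inner b fun i j => transposeOp_apply_inner b A j i

theorem hs_eq_sum_sum {ι : Type*} [Fintype ι] (b : OrthonormalBasis ι ℂ H) (X Y : H →ₗ[ℂ] H) :
    hs X Y = ∑ i, ∑ j, ⟪X (b i), b j⟫_ℂ * ⟪b j, Y (b i)⟫_ℂ := by
  rw [hs_eq_sum b]
  exact Finset.sum_congr rfl fun i _ => (b.sum_inner_mul_inner _ _).symm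

theorem hs_transposeOp {ι : Type*} [Fintype ι] [DecidableEq ι] (b : OrthonormalBasis ι ℂ H)
    (X Y : H →ₗ[ℂ] H) : hs (transposeOp b X) (transposeOp b Y) = hs X Y := by
  rw [hs_eq_sum_sum b, hs_eq_sum_sum b, Finset.sum_comm]
  refine Finset.sum_congr rfl fun i _ => Finset.sum_congr rfl fun j _ => ?_
  rw [← inner_conj_symm, transposeOp_apply_inner, transposeOp_apply_inner, inner_conj_symm]

theorem norm_hs_star (X Y : H →ₗ[ℂ] H) : ‖hs (star X) (star Y)‖ = ‖hs X Y‖ := by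
  rw [norm_hs_comm X Y, hs, hs, star_star, LinearMap.trace_mul_comm]

theorem OpSymmetry.not_forall_unitaryChannel_star (hdim : 2 ≤ Module.finrank ℂ H)
    (S : OpSymmetry H H H H)
    (hS : ∀ U, S.toFun (unitaryChannel U) = unitaryChannel (star U)) : False := by
  have hn0 : 0 < Module.finrank ℂ H := by omega
  let b := stdOrthonormalBasis ℂ H
  have hij : (⟨0, hn0⟩ : Fin (Module.finrank ℂ H)) ≠ ⟨1, hdim⟩ := by simp
  refine S.not_reverses hdim (τ := star) (σ := star) hS star_involutive.surjective
    (fun X => norm_hs_star X X) (fun X U => ?_) (b.orthonormal.1 ⟨0, hn0⟩)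
    (b.orthonormal.1 ⟨1, hdim⟩) (b.orthonormal.2 hij) (fun _ _ => star_ketBra _ _)
  rw [← norm_hs_star, Unitary.coe_star, star_star]

theorem OpSymmetry.not_forall_unitaryChannel_transpose (hdim : 2 ≤ Module.finrank ℂ H)
    {ι : Type*} [Fintype ι] [DecidableEq ι] (b : OrthonormalBasis ι ℂ H) (S : OpSymmetry H H H H)
    (hS : ∀ U, S.toFun (unitaryChannel U) = unitaryChannel (unitaryTranspose b U)) : False := by
  obtain ⟨i, j, hij⟩ := Fintype.exists_pair_of_one_lt_card (α := ι)
    (by rw [← Module.finrank_eq_card_basis b.toBasis]; omega)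
  refine S.not_reverses hdim (τ := unitaryTranspose b) (σ := transposeOp b) hS
    (fun U => ⟨unitaryTranspose b U, Subtype.ext (transposeOp_transposeOp b U)⟩)
    (fun X => by rw [hs_transposeOp]) (fun X U => ?_) (b.orthonormal.1 i) (b.orthonormal.1 j)
    (b.orthonormal.2 hij) (fun a c => eq_transposeOp_of_inner b fun k l => ?_)
  · rw [← hs_transposeOp b]
    exact congrArg (fun Z => ‖hs (transposeOp b X) Z‖) (transposeOp_transposeOp b U)
  -- real combinations of basis vectors are fixed by the conjugation that the transpose involves
  · simp only [ketBra_apply, inner_smul_right, inner_add_left, inner_add_right, inner_smul_left,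
      Complex.conj_ofReal, b.inner_eq_ite, eq_comm]
    ring

end QuantumEvolution

end

theorem theorem4 {H : Type*} [NormedAddCommGroup H] [InnerProductSpace ℂ H]
    [FiniteDimensional ℂ H] (hdim : 2 ≤ Module.finrank ℂ H) :
    (¬ ∃ S : QuantumEvolution.OpSymmetry H H H H, ∀ U : unitary (H →ₗ[ℂ] H),
        S.toFun (QuantumEvolution.unitaryChannel U) =
          QuantumEvolution.unitaryChannel (star U)) ∧
    (∀ {ι : Type*} [Fintype ι] [DecidableEq ι] (b : OrthonormalBasis ι ℂ H),
      ¬ ∃ S : QuantumEvolution.OpSymmetry H H H H, ∀ U : unitary (H →ₗ[ℂ] H),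
        S.toFun (QuantumEvolution.unitaryChannel U) =
          QuantumEvolution.unitaryChannel (QuantumEvolution.unitaryTranspose b U)) := by
  exact ⟨fun ⟨S, hS⟩ => S.not_forall_unitaryChannel_star hdim hS,
    fun b ⟨S, hS⟩ => S.not_forall_unitaryChannel_transpose hdim b hS⟩
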